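/- Let $G$ be a connected weighted multigraph (parallel edges and loops allowed, finitely many edges, all edge weights positive) with vertex set $\{1,\dots,n\}$, $n>2$, and let $A=(a_{xy})$ be its weighted adjacency matrix: $a_{xy}$ is the sum of the weights of all edges with ends $x$ and $y$. Let $0<t<\rho(A)^{-1}$, where $\rho$ denotes the spectral radius, and put $B=I-tA$. Let $i\ne j$ be vertices with $i+j$ even (which can always be achieved by renumbering the vertices). For a matrix $M$ let $M_{(ij)}$ be $M$ with row $i$ and column $j$ removed. Let $T_{ji}=I(i,j)_{(ji)}$, where $I(i,j)$ is the identity matrix with its $(i,j)$ entry replaced by $-1$. Assume $\rho\bigl(I-B_{(ij)}T_{ji}\bigr)<1$. *Notation.* $tG$ is $G$ with all edge weights multiplied by $t$, and $tG_{(ij)}$ is $tG$ with $i$, $j$ and all edges incident to them removed. A walk is a sequence of vertices and edges in which each edge joins the two neighbouring vertices; its length is the number of edges, its weight the product of their weights. A circuit is a class of closed walks of non-zero length up to cyclic shift, where the shift is of the sequence of edges together with the directions in which they are traversed. Its multiplicity is the largest $\mu$ such that its walks are $\mu$-fold repetitions of some walk. A walk with jumps in $tG$ is a walk in the graph obtained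 from $tG$ by attaching two additional loops of weight $1$, called jumps, one at $i$ and one at $j$. A *$j\to i$ alternating walk with jumps* is such a walk from $j$ to $i$ in which every $j\ldots j$ subwalk visits $i$ or contains no edges except for jumps, and every $i\ldots i$ subwalk visits $j$ or contains no edges except for jumps. A *$j\to i\to j$ alternating walk with jumps* is defined in the same way, but it ends at $j$. Each such walk $\omega$ is uniquely partitioned into consecutive subwalks $\omega_1,\dots,\omega_s$, each of which is a single jump or a jump-free walk from $j$ to $i$ or from $i$ to $j$ that visits its final vertex only once. Let $p_k=\{\omega_k,\tilde\omega_k\}$, where $\tilde\omega_k$ is the jump at the other of the vertices $i,j$ if $\omega_k$ is a jump, and $\omega_k$ reversed otherwise. An *alternating $j\to i$ route* (respectively *$j\to i\to j$ route*) *with jumps* is a class of $j\to i$ (respectively $j\to i\to j$) alternating walks with jumps whose sequences $(p_1,\dots,p_s)$ coincide up to cyclic shift. Its length and weight are the common length (jumps counted) and weight of its walks. Its multiplicity is $s/y$, where $y$ is the length of the elementary repeating part of $(p_1,\dots,p_s)$. Let $\mathcal C^{\overline{ij}}$ be the set of circuits in $tG_{(ij)}$, $\mathcal C^{j\to i\to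 j}$ the set of alternating $j\to i\to j$ routes with jumps in $tG$, $\mathcal C^{j\to i}$ the set of alternating $j\to i$ routes with jumps in $tG$, and $\mathcal C_k$ the set of those figures (circuits and routes) that have length $k$. Let $w(c)$ and $\mu(c)$ be the weight and the multiplicity of $c$. *Claim.* $\det B_{(ij)}>0$, for each $k$ there are only finitely many figures of length $k$, and $$-\ln\det B_{(ij)}=\sum_{k=1}^{\infty}\ \sum_{c\in(\mathcal C^{\overline{ij}}\cup\mathcal C^{j\to i\to j}\cup\mathcal C^{j\to i})\cap\mathcal C_k}(-1)^{\zeta(c)}\,\frac{w(c)}{\mu(c)},$$ where $\zeta(c)=0$ for $c\in\mathcal C^{\overline{ij}}\cup\mathcal C^{j\to i\to j}$ and $\zeta(c)=1$ for $c\in\mathcal C^{j\to i}$; the series over $k$ converges (absolutely). -/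

import Mathlib

/-- A weighted multigraph (parallel edges and loops are allowed): a multigraph whose edges carry
real weights. -/
structure WeightedMultigraph (α β : Type*) extends Graph α β where
  weight : β → ℝ

/-- One step of a walk: the edge `edge` traversed from the vertex `tail` to the vertex `head`. -/
structure Arc (α β : Type*) where
  tail : α
  edge : β
  head : α

/-- The same edge traversed in the opposite direction. -/
def Arc.rev {α β : Type*} (a : Arc α β) : Arc α β := ⟨a.head, a.edge, a.tail⟩

/-- The cyclic sequence `c` is the `m`-fold repetition of the sequence `q`. -/
def Cycle.IsRepetition {γ : Type*} (c : Cycle γ) (m : ℕ) (q : List γ) : Prop :=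
  (((List.replicate m q).flatten : List γ) : Cycle γ) = c

namespace WeightedMultigraph

variable {α β : Type*}

/-- The graph `tG`: all edge weights are multiplied by `t`. -/
def scale (t : ℝ) (G : WeightedMultigraph α β) : WeightedMultigraph α β where
  toGraph := G.toGraph
  weight e := t * G.weight e

/-- `G` with the vertices `i`, `j` and all edges incident to them removed. -/
def deletePair (G : WeightedMultigraph α β) (i j : α) : WeightedMultigraph α β where
  toGraph := G.toGraph.deleteVerts {i, j}
  weight := G.weight

open Classical in
/-- The weighted adjacency matrix: the entry at `x, y` is the total weight of the edges
with ends `x` and `y`. -/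
noncomputable def adjMatrix [Fintype β] (G : WeightedMultigraph α β) : Matrix α α ℝ :=
  Matrix.of fun x y => ∑ e : β, if G.IsLink e x y then G.weight e else 0

/-- `G.IsWalk x l y`: the list of arcs `l` is (together with its first vertex `x`) a walk
from `x` to `y` in `G`. -/
def IsWalk (G : WeightedMultigraph α β) : α → List (Arc α β) → α → Prop
  | x, [], y => x ∈ G.vertexSet ∧ x = y
  | x, a :: l, y => a.tail = x ∧ G.IsLink a.edge a.tail a.head ∧ IsWalk G a.head l y

/-- Any two vertices are joined by a walk. -/
def IsConnected (G : WeightedMultigraph α β) : Prop :=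
  G.vertexSet.Nonempty ∧ ∀ x ∈ G.vertexSet, ∀ y ∈ G.vertexSet, ∃ l, G.IsWalk x l y

/-- The weight of a walk. -/
def walkWeight (G : WeightedMultigraph α β) (l : List (Arc α β)) : ℝ :=
  (l.map fun a => G.weight a.edge).prod

/-- A hitting walk from `x` to `y`: the final vertex `y` occurs only once, that is, it is not the
tail of any of the arcs. -/
def IsHittingWalk (G : WeightedMultigraph α β) (x : α) (l : List (Arc α β)) (y : α) : Prop :=
  G.IsWalk x l y ∧ ∀ a ∈ l, a.tail ≠ y

/-! ### Circuits -/

/-- The circuits of `G`: closed walks of non-zero length, up to cyclic shifts. -/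
def circuits (G : WeightedMultigraph α β) : Set (Cycle (Arc α β)) :=
  {c | ∃ x l, l ≠ [] ∧ G.IsWalk x l x ∧ (l : Cycle (Arc α β)) = c}

/-- The weight of a circuit: the product of the weights of its arcs. -/
def circuitWeight (G : WeightedMultigraph α β) (c : Cycle (Arc α β)) : ℝ :=
  (c.toMultiset.map fun a => G.weight a.edge).prod

/-- The multiplicity of a circuit: the largest `m` such that it is the `m`-fold repetition of
some walk. -/
noncomputable def circuitMultiplicity (c : Cycle (Arc α β)) : ℕ :=
  sSup {m | ∃ q, c.IsRepetition m q}

/-! ### Walks with jumps -/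

/-- `G` with two additional loops of weight `1` (the jumps), one at `i` and one at `j`;
the jump at `v` is the edge `Sum.inr v`. -/
def withJumps (G : WeightedMultigraph α β) (i j : α) : WeightedMultigraph α (β ⊕ α) where
  vertexSet := G.vertexSet
  IsLink e x y := match e with
    | Sum.inl e => G.IsLink e x y
    | Sum.inr v => v ∈ G.vertexSet ∧ (v = i ∨ v = j) ∧ x = v ∧ y = v
  isLink_symm := by
    rintro (e | v) -
    · exact ⟨fun x y h => Graph.IsLink.symm h⟩
    · exact ⟨fun x y h => ⟨h.1, h.2.1, h.2.2.2, h.2.2.1⟩⟩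
  eq_or_eq_of_isLink_of_isLink := by
    rintro (e | v) x y z w h h'
    · exact G.eq_or_eq_of_isLink_of_isLink h h'
    · exact Or.inl (h.2.2.1.trans h'.2.2.1.symm)
  left_mem_of_isLink := by
    rintro (e | v) x y h
    · exact G.left_mem_of_isLink h
    · exact h.2.2.1 ▸ h.1
  weight := Sum.elim G.weight fun _ => 1

/-- The jump at the vertex `v`, as an arc. -/
def jumpArc (v : α) : Arc α (β ⊕ α) := ⟨v, Sum.inr v, v⟩

/-- The arc is a jump. -/
def IsJump (a : Arc α (β ⊕ α)) : Prop := a.edge.isRight = true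

/-- The vertex `v` is visited by the (nonempty) walk `l`. -/
def Visits (l : List (Arc α β)) (v : α) : Prop := ∃ a ∈ l, a.tail = v ∨ a.head = v

/-- `l` is an alternating walk with jumps starting at `j` and ending at `z`: every `j … j` subwalk
visits `i` or has no edges except for jumps, and every `i … i` subwalk visits `j` or has no edges
except for jumps. For `z = i` these are the `j → i` alternating walks with jumps, for `z = j` the
`j → i → j` alternating walks with jumps. -/
def IsAlternating (G : WeightedMultigraph α β) (i j z : α) (l : List (Arc α (β ⊕ α))) : Prop :=
  (G.withJumps i j).IsWalk j l z ∧
  (∀ s, s <:+: l → (G.withJumps i j).IsWalk j s j → Visits s i ∨ ∀ a ∈ s, IsJump a) ∧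
  (∀ s, s <:+: l → (G.withJumps i j).IsWalk i s i → Visits s j ∨ ∀ a ∈ s, IsJump a)

/-- `u` is a jump walk at `i` or `j`, or a hitting walk without jumps from `j` to `i` or from
`i` to `j`. -/
def IsPart (G : WeightedMultigraph α β) (i j : α) (u : List (Arc α (β ⊕ α))) : Prop :=
  (u = [jumpArc i] ∨ u = [jumpArc j]) ∨
  (((G.withJumps i j).IsHittingWalk j u i ∨ (G.withJumps i j).IsHittingWalk i u j) ∧
    ∀ a ∈ u, ¬ IsJump a)

/-- `P` is a partition of the walk `l` into consecutive subwalks, each of which is a jump walk or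
a hitting walk without jumps between `i` and `j`. -/
def IsPartition (G : WeightedMultigraph α β) (i j : α) (l : List (Arc α (β ⊕ α)))
    (P : List (List (Arc α (β ⊕ α)))) : Prop :=
  P.flatten = l ∧ ∀ u ∈ P, G.IsPart i j u

open Classical in
/-- The partition of `l` into jump walks and hitting walks without jumps (it exists and is unique
for every alternating walk with jumps; the value for other lists is irrelevant). -/
noncomputable def partition (G : WeightedMultigraph α β) (i j : α) (l : List (Arc α (β ⊕ α))) :
    List (List (Arc α (β ⊕ α))) :=
  if h : ∃ P, G.IsPartition i j l P then h.choose else [l]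

open Classical in
/-- The companion of a part: the jump walk at the other vertex if `u` is a jump walk,
and `u` written from end to beginning otherwise. -/
noncomputable def twin (i j : α) (u : List (Arc α (β ⊕ α))) : List (Arc α (β ⊕ α)) :=
  if u = [jumpArc i] then [jumpArc j]
  else if u = [jumpArc j] then [jumpArc i]
  else (u.map Arc.rev).reverse

/-- The unordered pair consisting of a part and its companion. -/
noncomputable def partPair (i j : α) (u : List (Arc α (β ⊕ α))) : Sym2 (List (Arc α (β ⊕ α))) :=
  s(u, twin i j u)

/-- The route partition of `l`. -/
noncomputable def routePartition (G : WeightedMultigraph α β) (i j : α)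
    (l : List (Arc α (β ⊕ α))) : List (Sym2 (List (Arc α (β ⊕ α)))) :=
  (G.partition i j l).map (partPair i j)

/-- The alternating walks with jumps from `j` to `z`. -/
def AlternatingWalk (G : WeightedMultigraph α β) (i j z : α) : Type _ :=
  {l : List (Arc α (β ⊕ α)) // G.IsAlternating i j z l}

/-- Two alternating walks with jumps are equipartite if their route partitions are cyclic shifts
of each other. -/
noncomputable def equipartite (G : WeightedMultigraph α β) (i j z : α) : Setoid (G.AlternatingWalk i j z) :=
  (List.IsRotated.setoid _).comap fun l => G.routePartition i j l.1

/-- The alternating routes with jumps: equivalence classes of equipartite alternating walks with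
jumps (`j → i` routes for `z = i`, `j → i → j` routes for `z = j`). -/
noncomputable def Route (G : WeightedMultigraph α β) (i j z : α) : Type _ :=
  Quotient (G.equipartite i j z)

theorem partition_flatten (G : WeightedMultigraph α β) (i j : α) (l : List (Arc α (β ⊕ α))) :
    (G.partition i j l).flatten = l := by
  unfold partition
  split_ifs with h
  · exact h.choose_spec.1
  · simp

theorem length_twin (i j : α) (u : List (Arc α (β ⊕ α))) : (twin i j u).length = u.length := by
  unfold twin
  split_ifs with h h' <;> simp_all

theorem walkWeight_twin (G : WeightedMultigraph α β) (i j : α) (u : List (Arc α (β ⊕ α))) :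
    (G.withJumps i j).walkWeight (twin i j u) = (G.withJumps i j).walkWeight u := by
  unfold twin
  split_ifs with h h'
  · simp [h, walkWeight, jumpArc, withJumps]
  · simp [h', walkWeight, jumpArc, withJumps]
  · simp only [walkWeight, List.map_reverse, List.prod_reverse, List.map_map]
    rfl

theorem partPair_factors {M : Type*} (i j : α) (f : List (Arc α (β ⊕ α)) → M)
    (hf : ∀ u, f (twin i j u) = f u) : Function.FactorsThrough f (partPair i j) := by
  intro u v h
  rcases Sym2.eq_iff.1 h with ⟨h, -⟩ | ⟨h, -⟩
  · rw [h]
  · rw [h, hf]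

theorem perm_of_routePartition {M : Type*} [Inhabited M] (G : WeightedMultigraph α β) (i j : α)
    (f : List (Arc α (β ⊕ α)) → M) (hf : ∀ u, f (twin i j u) = f u)
    {l l' : List (Arc α (β ⊕ α))} (h : G.routePartition i j l ~r G.routePartition i j l') :
    ((G.partition i j l).map f).Perm ((G.partition i j l').map f) := by
  have key : f = Function.extend (partPair i j) f (fun _ => default) ∘ partPair i j := by
    funext u
    exact ((partPair_factors i j f hf).extend_apply _ u).symm
  rw [key, ← List.map_map, ← List.map_map]
  exact h.perm.map _

theorem length_congr (G : WeightedMultigraph α β) (i j : α) {l l' : List (Arc α (β ⊕ α))}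
    (h : G.routePartition i j l ~r G.routePartition i j l') : l.length = l'.length := by
  rw [← G.partition_flatten i j l, ← G.partition_flatten i j l', List.length_flatten,
    List.length_flatten]
  exact (G.perm_of_routePartition i j List.length (length_twin i j) h).sum_eq

theorem walkWeight_congr (G : WeightedMultigraph α β) (i j : α) {l l' : List (Arc α (β ⊕ α))}
    (h : G.routePartition i j l ~r G.routePartition i j l') :
    (G.withJumps i j).walkWeight l = (G.withJumps i j).walkWeight l' := by
  have key : ∀ l, (G.withJumps i j).walkWeight l =
      ((G.partition i j l).map (G.withJumps i j).walkWeight).prod := by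
    intro l
    conv_lhs => rw [← G.partition_flatten i j l]
    simp only [walkWeight, List.map_flatten, List.prod_flatten, List.map_map]
    rfl
  rw [key, key]
  exact (G.perm_of_routePartition i j _ (G.walkWeight_twin i j) h).prod_eq

namespace Route

variable {G : WeightedMultigraph α β} {i j z : α}

/-- The length of a route: the common length of the walks with jumps that it includes. -/
noncomputable def length : G.Route i j z → ℕ :=
  Quotient.lift (fun l => l.1.length) fun _ _ h => G.length_congr i j h

/-- The weight of a route: the common weight of the walks with jumps that it includes. -/
noncomputable def weight : G.Route i j z → ℝ :=
  Quotient.lift (fun l => (G.withJumps i j).walkWeight l.1) fun _ _ h => G.walkWeight_congr i j h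

/-- The route partition of a route, up to cyclic shifts. -/
noncomputable def cyclicPartition : G.Route i j z → Cycle (Sym2 (List (Arc α (β ⊕ α)))) :=
  Quotient.lift (fun l => (G.routePartition i j l.1 : Cycle _)) fun _ _ h => Cycle.coe_eq_coe.2 h

/-- The period of the route partition: the length of its elementary repeating part. -/
noncomputable def period (r : G.Route i j z) : ℕ :=
  sInf {y | ∃ m q, q.length = y ∧ r.cyclicPartition.IsRepetition m q}

/-- The multiplicity of a route: the number of parts divided by the period. -/
noncomputable def multiplicity (r : G.Route i j z) : ℕ :=
  r.cyclicPartition.length / r.period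

end Route

/-! ### Figures -/

/-- The figures: circuits of `G` with `i` and `j` deleted, alternating `j → i → j` routes with
jumps in `G`, and alternating `j → i` routes with jumps in `G`. -/
inductive Figure (G : WeightedMultigraph α β) (i j : α)
  | circuit (c : (G.deletePair i j).circuits)
  | closedRoute (r : G.Route i j j)
  | openRoute (r : G.Route i j i)

namespace Figure

variable {G : WeightedMultigraph α β} {i j : α}

/-- The number of arcs of a figure (jumps are counted). -/
noncomputable def length : G.Figure i j → ℕ
  | circuit c => c.1.length
  | closedRoute r => r.length
  | openRoute r => r.length

/-- The weight of a figure. -/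
noncomputable def weight : G.Figure i j → ℝ
  | circuit c => (G.deletePair i j).circuitWeight c.1
  | closedRoute r => r.weight
  | openRoute r => r.weight

/-- The multiplicity of a figure. -/
noncomputable def multiplicity : G.Figure i j → ℕ
  | circuit c => circuitMultiplicity c.1
  | closedRoute r => r.multiplicity
  | openRoute r => r.multiplicity

/-- The sign exponent of a figure. -/
def zeta : G.Figure i j → ℕ
  | circuit _ => 0
  | closedRoute _ => 0
  | openRoute _ => 1

end Figure

end WeightedMultigraph

/-! ### Matrices -/

/-- The spectral radius of a real matrix (over its complex eigenvalues). -/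
noncomputable def Matrix.specRad {n : ℕ} (M : Matrix (Fin n) (Fin n) ℝ) : ENNReal :=
  spectralRadius ℂ (M.map (algebraMap ℝ ℂ))

/-- `M` with row `i` and column `j` removed. -/
def Matrix.removeRowCol {n : ℕ} (M : Matrix (Fin (n + 1)) (Fin (n + 1)) ℝ) (i j : Fin (n + 1)) :
    Matrix (Fin n) (Fin n) ℝ :=
  M.submatrix i.succAbove j.succAbove

/-- The identity matrix with the entry at `p, q` replaced by `-1`. -/
def Matrix.oneWithNeg {n : ℕ} (p q : Fin (n + 1)) : Matrix (Fin (n + 1)) (Fin (n + 1)) ℝ :=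
  (1 : Matrix (Fin (n + 1)) (Fin (n + 1)) ℝ).updateRow p
    (Function.update ((1 : Matrix (Fin (n + 1)) (Fin (n + 1)) ℝ) p) q (-1))

/-- The matrix `T p q`: the identity matrix with the entry at `q, p` replaced by `-1`, with
row `p` and column `q` removed. -/
def Matrix.transfer {n : ℕ} (p q : Fin (n + 1)) : Matrix (Fin n) (Fin n) ℝ :=
  (Matrix.oneWithNeg q p).removeRowCol p q

/-! Put C = 1 - B_(ij) T_(ji). Since det T_(ji) = 1, det B_(ij) = det (1 - C). As ρ(C) < 1, this
determinant is positive and minus its logarithm is Σ tr(C^k)/k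
(`Matrix.det_one_sub_pos_and_hasSum`). It remains to show, for each k ≥ 1 separately, that the
figures of length k add up to tr(C^k)/k (`finsum_figures_eq_trace`).

Let A be the adjacency matrix of tG and Q the projection that kills the coordinates i and j.
Bordered by a zero row and column at i, C becomes L + e_j r, where L carries the rows other than j
and r is the row at j (`Matrix.transit`). With F(z) = Σ (r L^m e_j) z^(m+1) one has det(1 - zC) =
det(1 - zL)(1 - F(z)). In logarithmic form this says that tr(C^k)/k = tr(L^k)/k + [z^k] Σ F^s/s
(`Matrix.trace_add_vecMulVec_pow`). Here tr(L^k) = tr((QA)^k) counts the closed walks that avoid i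
and j, which gives the circuits. Moreover F = z - Σ (A(QA)^m)_{ji} z^(m+1): its letters are one
jump, of weight 1, and the excursions from j to i, with a minus sign.

So [z^k] Σ F^s/s sums over words in these letters, each divided by its number s of letters. A word
unfolds into a walk from j: an excursion is traversed backwards, and the jump replaced by the one at
i, whenever the walk stands at i. Excursions change sides and jumps do not. The walks so obtained
are exactly the alternating ones (`isAlternating_iff`), and the route partition recovers the word,
so routes are words up to cyclic shift. The sign of a word is the parity of its number of
excursions, which decides whether the walk ends at j or at i.

Finally, a cyclic class with s letters and multiplicity μ contains s/μ words, so the weights 1/s add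
up to 1/μ (`finsum_div_multiplicity`). The same count handles closed walks and circuits. -/

/-! ### Cyclic shifts, periods and multiplicities -/

section Rotation

open Function

/-- The least number of cyclic shifts that bring a list back. -/
noncomputable def List.rotationPeriod {γ : Type*} (l : List γ) : ℕ :=
  minimalPeriod (fun l : List γ => l.rotate 1) l

namespace List

variable {γ : Type*}

theorem iterate_rotate_one (k : ℕ) (l : List γ) :
    (fun l : List γ => l.rotate 1)^[k] l = l.rotate k := by
  induction k with
  | zero => simp
  | succ k ih => rw [iterate_succ_apply', ih, rotate_rotate]

theorem isPeriodicPt_rotate_one_iff {k : ℕ} {l : List γ} :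
    IsPeriodicPt (fun l : List γ => l.rotate 1) k l ↔ l.rotate k = l := by
  rw [IsPeriodicPt, IsFixedPt, iterate_rotate_one]

theorem rotationPeriod_dvd_iff {k : ℕ} {l : List γ} : l.rotationPeriod ∣ k ↔ l.rotate k = l := by
  rw [rotationPeriod, ← isPeriodicPt_iff_minimalPeriod_dvd, isPeriodicPt_rotate_one_iff]

theorem rotationPeriod_dvd_length (l : List γ) : l.rotationPeriod ∣ l.length :=
  rotationPeriod_dvd_iff.2 l.rotate_length

theorem rotationPeriod_pos {l : List γ} (hl : l ≠ []) : 0 < l.rotationPeriod :=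
  Nat.pos_of_dvd_of_pos l.rotationPeriod_dvd_length (length_pos_iff.2 hl)

/-- A rotation class is one orbit of the shift by one, and an orbit has as many points as the
minimal period. -/
theorem ncard_isRotated {l : List γ} (hl : l ≠ []) : {l' | l ~r l'}.ncard = l.rotationPeriod := by
  classical
  have h : {l' | l ~r l'} = ((Finset.range l.rotationPeriod).image fun k => l.rotate k : Finset _) := by
    ext l'
    simp only [Set.mem_ofPred_eq, Finset.coe_image, Set.mem_image, Finset.coe_range, Set.mem_Iio]
    constructor
    · rintro ⟨k, rfl⟩
      refine ⟨k % l.rotationPeriod, Nat.mod_lt _ (rotationPeriod_pos hl), ?_⟩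
      rw [← iterate_rotate_one, ← iterate_rotate_one, rotationPeriod,
        iterate_mod_minimalPeriod_eq]
    · rintro ⟨k, -, rfl⟩
      exact ⟨k, rfl⟩
  rw [h, Set.ncard_coe_finset, Finset.card_image_of_injOn, Finset.card_range]
  intro a ha b hb hab
  beta_reduce at hab
  simp only [Finset.coe_range, Set.mem_Iio] at ha hb
  rw [← iterate_rotate_one, ← iterate_rotate_one] at hab
  exact (iterate_eq_iterate_iff_of_lt_minimalPeriod ha hb).1 hab

theorem eq_flatten_replicate {l : List γ} {p m : ℕ} (h : l.rotate p = l) (hm : l.length = m * p) :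
    l = (replicate m (l.take p)).flatten := by
  have key : ∀ m, m * p ≤ l.length → l.take (m * p) = (replicate m (l.take p)).flatten := by
    intro m
    induction m with
    | zero => simp
    | succ m ih =>
      intro hle
      have hle' : m * p + p ≤ l.length := by rwa [Nat.succ_mul] at hle
      rw [replicate_succ', flatten_append, ← ih (by omega), Nat.succ_mul, take_add]
      congr 1
      -- Multiples of `p` fix `l` too, so the block that starts at position `m * p` is the initial
      -- block again.
      have h1 : l.rotate (m * p) = l := by
        rw [← rotationPeriod_dvd_iff]
        exact (rotationPeriod_dvd_iff.2 h).mul_left m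
      have h2 : l = l.drop (m * p) ++ l.take (m * p) := by
        rw [← rotate_eq_drop_append_take (by omega), h1]
      simp only [flatten_cons, flatten_nil, append_nil]
      conv_rhs => rw [h2]
      rw [take_append_of_le_length (by rw [length_drop]; omega)]
  have := key m hm.ge
  rwa [← hm, take_length] at this

theorem rotate_length_flatten_replicate (m : ℕ) (q : List γ) :
    (replicate m q).flatten.rotate q.length = (replicate m q).flatten := by
  cases m with
  | zero => simp
  | succ m =>
    rw [replicate_succ, flatten_cons, rotate_append_length_eq]
    induction m with
    | zero => simp
    | succ m ih => rw [replicate_succ, flatten_cons, append_assoc, ih]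

theorem IsRotated.rotationPeriod_eq {l l' : List γ} (h : l ~r l') :
    l.rotationPeriod = l'.rotationPeriod := by
  have key : ∀ {l l' : List γ}, l ~r l' → l.rotationPeriod ∣ l'.rotationPeriod := by
    rintro l l' ⟨k, rfl⟩
    have h1 := rotationPeriod_dvd_iff.1 (dvd_refl (l.rotate k).rotationPeriod)
    rw [rotationPeriod_dvd_iff]
    rw [rotate_rotate, add_comm, ← rotate_rotate] at h1
    exact rotate_injective k h1
  exact Nat.dvd_antisymm (key h) (key h.symm)

end List

namespace Cycle

variable {γ : Type*}

/-- Periods are invariant under rotation, so the block length of a repetition of the cycle is a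
period of any representing list. -/
theorem IsRepetition.rotate {l q : List γ} {m : ℕ} (h : (l : Cycle γ).IsRepetition m q) :
    l.rotate q.length = l ∧ l.length = m * q.length := by
  have h1 := Cycle.coe_eq_coe.1 h
  constructor
  · rw [← List.rotationPeriod_dvd_iff, ← h1.rotationPeriod_eq, List.rotationPeriod_dvd_iff]
    exact List.rotate_length_flatten_replicate m q
  · rw [← h1.perm.length_eq]
    simp

theorem isRepetition_take (l : List γ) :
    (l : Cycle γ).IsRepetition (l.length / l.rotationPeriod) (l.take l.rotationPeriod) := by
  refine congrArg _ (List.eq_flatten_replicate ?_ ?_).symm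
  · rw [← List.rotationPeriod_dvd_iff]
  · exact (Nat.div_mul_cancel l.rotationPeriod_dvd_length).symm

theorem length_take_rotationPeriod {l : List γ} (hl : l ≠ []) :
    (l.take l.rotationPeriod).length = l.rotationPeriod := by
  rw [List.length_take, min_eq_left]
  exact Nat.le_of_dvd (List.length_pos_iff.2 hl) l.rotationPeriod_dvd_length

/-- The block length of every repetition is a multiple of the rotation period, so the longest
repetition uses the block of exactly that length. -/
theorem sSup_isRepetition {l : List γ} (hl : l ≠ []) :
    sSup {m | ∃ q, (l : Cycle γ).IsRepetition m q} = l.length / l.rotationPeriod := by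
  refine IsGreatest.csSup_eq ⟨⟨_, isRepetition_take l⟩, ?_⟩
  rintro m ⟨q, hq⟩
  obtain ⟨h1, h2⟩ := hq.rotate
  rw [Nat.le_div_iff_mul_le (List.rotationPeriod_pos hl), h2]
  refine Nat.mul_le_mul_left m (Nat.le_of_dvd ?_ (List.rotationPeriod_dvd_iff.2 h1))
  by_contra h0
  have : q.length = 0 := by omega
  rw [this, mul_zero] at h2
  exact hl (List.length_eq_zero_iff.1 h2)

theorem sInf_isRepetition {l : List γ} (hl : l ≠ []) :
    sInf {y | ∃ m q, q.length = y ∧ (l : Cycle γ).IsRepetition m q} = l.rotationPeriod := by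
  refine IsLeast.csInf_eq ⟨⟨_, _, length_take_rotationPeriod hl, isRepetition_take l⟩, ?_⟩
  rintro _ ⟨m, q, rfl, hq⟩
  obtain ⟨h1, h2⟩ := hq.rotate
  refine Nat.le_of_dvd ?_ (List.rotationPeriod_dvd_iff.2 h1)
  by_contra h0
  have : q.length = 0 := by omega
  rw [this, mul_zero] at h2
  exact hl (List.length_eq_zero_iff.1 h2)

end Cycle

/-- Weighing every cycle by the reciprocal of its multiplicity amounts to weighing every list by
the reciprocal of its length. -/
theorem finsum_div_multiplicity {γ ι : Type*} {S : Set (List γ)} (hS : S.Finite)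
    (hne : ∀ l ∈ S, l ≠ []) (hrot : ∀ l ∈ S, ∀ l', l ~r l' → l' ∈ S) {J : Set ι}
    {κ : ι → Cycle γ} (hκ : Set.InjOn κ J) (hJS : κ '' J = (fun l : List γ => (l : Cycle γ)) '' S)
    {f : List γ → ℝ} {g : ι → ℝ} {μ : ι → ℕ}
    (hfg : ∀ x ∈ J, ∀ l ∈ S, κ x = l → g x = f l ∧ μ x = l.length / l.rotationPeriod) :
    ∑ᶠ x ∈ J, g x / μ x = ∑ᶠ l ∈ S, f l / l.length := by
  have hJ : J.Finite := by
    refine Set.Finite.of_finite_image ?_ hκ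
    rw [hJS]
    exact hS.image _
  have hpart : S = ⋃ x ∈ J, {l | l ∈ S ∧ κ x = l} := by
    ext l
    simp only [Set.mem_iUnion, Set.mem_ofPred_eq, exists_and_left, exists_prop]
    constructor
    · intro hl
      have : (l : Cycle γ) ∈ κ '' J := hJS ▸ Set.mem_image_of_mem _ hl
      obtain ⟨x, hx, hxl⟩ := this
      exact ⟨hl, x, hx, hxl⟩
    · rintro ⟨hl, -⟩
      exact hl
  conv_rhs => rw [hpart]
  rw [finsum_mem_biUnion]
  · refine finsum_mem_congr rfl fun x hx => ?_
    obtain ⟨l, hl, hlx⟩ : κ x ∈ (fun l : List γ => (l : Cycle γ)) '' S := by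
      rw [← hJS]; exact Set.mem_image_of_mem _ hx
    obtain ⟨h1, h2⟩ := hfg x hx l hl hlx.symm
    -- The fibre over `x` is a full rotation class: `l.rotationPeriod` lists contribute `f l /
    -- l.length` each, which is `f l / μ x` in total.
    have hfib : {l' | l' ∈ S ∧ κ x = l'} = {l' | l ~r l'} := by
      ext l'
      simp only [Set.mem_ofPred_eq, ← hlx, Cycle.coe_eq_coe]
      exact ⟨fun h => h.2, fun h => ⟨hrot l hl l' h, h⟩⟩
    have hval : ∀ l' ∈ {l' | l ~r l'}, f l' / l'.length = g x / l.length := by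
      intro l' hl'
      have hlen : l.length = l'.length := List.IsRotated.perm hl' |>.length_eq
      rw [← hfib] at hl'
      rw [(hfg x hx l' hl'.1 hl'.2).1, hlen]
    have hfin : {l' | l ~r l'}.Finite := hfib ▸ hS.subset fun l' h => h.1
    rw [hfib, finsum_mem_congr rfl hval, finsum_mem_eq_finite_toFinset_sum _ hfin,
      Finset.sum_const, ← Set.ncard_eq_toFinset_card _ hfin, List.ncard_isRotated (hne l hl), h2,
      nsmul_eq_mul]
    have hl0 : (l.length : ℝ) ≠ 0 := by
      exact_mod_cast (List.length_pos_iff.2 (hne l hl)).ne'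
    have hp0 : (l.rotationPeriod : ℝ) ≠ 0 := by
      exact_mod_cast (List.rotationPeriod_pos (hne l hl)).ne'
    rw [Nat.cast_div l.rotationPeriod_dvd_length hp0]
    field_simp
  · intro x hx y hy hxy
    refine Set.disjoint_left.2 fun l h1 h2 => hxy (hκ hx hy (h1.2.trans h2.2.symm))
  · exact hJ
  · exact fun x _ => hS.subset fun l h => h.1

end Rotation

/-! ### Eigenvalues, traces of powers and the logarithm of the determinant -/

namespace Matrix

open Polynomial

/-- Both sides are multiplicative in `q`, and over an algebraically closed field `q` is a product of
constants and factors `X - C a`. For the latter, both sides are the characteristic polynomial at `a`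
up to the same sign. -/
theorem det_aeval_eq_prod_roots {K ι : Type*} [Field K] [IsAlgClosed K] [Fintype ι] [DecidableEq ι]
    (A : Matrix ι ι K) (q : K[X]) :
    (aeval A q).det = (A.charpoly.roots.map fun r => q.eval r).prod := by
  let φ : K[X] →* K := (Matrix.detMonoidHom).comp ((aeval A : K[X] →ₐ[K] Matrix ι ι K).toRingHom.toMonoidHom)
  let ψ : K[X] →* K :=
    { toFun := fun q => (A.charpoly.roots.map fun r => q.eval r).prod
      map_one' := by simp
      map_mul' := fun p q => by simp [Multiset.prod_map_mul] }
  have hcard : Multiset.card A.charpoly.roots = Fintype.card ι := by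
    rw [← A.charpoly_natDegree_eq_dim]
    exact (IsAlgClosed.splits A.charpoly).natDegree_eq_card_roots.symm
  have hC : ∀ a : K, φ (C a) = ψ (C a) := by
    intro a
    simp [φ, ψ, hcard, Algebra.algebraMap_eq_smul_one]
  have hX : ∀ a : K, φ (X - C a) = ψ (X - C a) := by
    intro a
    have h1 : φ (X - C a) = (A - scalar ι a).det := by
      simp [φ, Matrix.algebraMap_eq_diagonal, scalar]
    have h2 : ψ (X - C a) = (A.charpoly.roots.map fun r => r - a).prod := by simp [ψ]
    have h3 : A.charpoly.eval a = (A.charpoly.roots.map fun r => a - r).prod := by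
      conv_lhs => rw [(IsAlgClosed.splits A.charpoly).eq_prod_roots_of_monic A.charpoly_monic]
      simp [eval_multiset_prod]
    rw [eval_charpoly] at h3
    have h4 : (A - scalar ι a) = -(scalar ι a - A) := by simp
    rw [h1, h2, h4, det_neg, h3]
    have h5 : (fun r => r - a) = fun r => -1 * (a - r) := by ext; ring
    rw [h5, Multiset.prod_map_mul, Multiset.map_const', Multiset.prod_replicate, hcard]
  have h := IsAlgClosed.splits q
  have : φ q = ψ q := by
    rw [h.eq_prod_roots, map_mul, map_mul, hC, map_multiset_prod, map_multiset_prod,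
      Multiset.map_map, Multiset.map_map]
    congr 2
    exact Multiset.map_congr rfl fun a _ => hX a
  exact this

/-- Applying the determinant formula to `C a - X ^ k` for all `a` identifies the roots of the
characteristic polynomial of `A ^ k`, with multiplicity. -/
theorem trace_pow_eq_sum_roots {K ι : Type*} [Field K] [IsAlgClosed K] [Fintype ι] [DecidableEq ι]
    (A : Matrix ι ι K) (k : ℕ) :
    (A ^ k).trace = (A.charpoly.roots.map fun r => r ^ k).sum := by
  have h : (A ^ k).charpoly = ((A.charpoly.roots.map fun r => r ^ k).map fun r => X - C r).prod := by
    refine Polynomial.funext fun a => ?_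
    have := det_aeval_eq_prod_roots A (C a - X ^ k)
    simp only [map_sub, aeval_C, map_pow, aeval_X, eval_sub, eval_C, eval_pow, eval_X] at this
    rw [eval_charpoly, eval_multiset_prod]
    simpa [Matrix.algebraMap_eq_diagonal, scalar] using! this
  rw [trace_eq_sum_roots_charpoly, h, roots_multiset_prod_X_sub_C]

/-- For a real matrix of spectral radius less than one, the determinant of `1 - C` is positive and
minus its logarithm is the sum of the series `tr (C ^ k) / k`. -/
theorem det_one_sub_pos_and_hasSum {n : ℕ} (A : Matrix (Fin n) (Fin n) ℝ) (h : A.specRad < 1) :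
    0 < (1 - A).det ∧
      HasSum (fun k : ℕ => (A ^ (k + 1)).trace / ((k + 1 : ℕ) : ℝ)) (-Real.log (1 - A).det) := by
  set M : Matrix (Fin n) (Fin n) ℂ := A.map (algebraMap ℝ ℂ) with hM
  set R := M.charpoly.roots with hR
  have hlt : ∀ r ∈ R, ‖r‖ < 1 := by
    intro r hr
    have h1 : r ∈ spectrum ℂ M := by
      rw [mem_spectrum_iff_isRoot_charpoly]
      exact isRoot_of_mem_roots hr
    have h2 : (‖r‖₊ : ENNReal) ≤ spectralRadius ℂ M :=
      le_iSup₂ (f := fun (k : ℂ) (_ : k ∈ spectrum ℂ M) => (‖k‖₊ : ENNReal)) r h1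
    have h3 := h2.trans_lt h
    exact_mod_cast h3
  have hsum : ∀ S : Multiset ℂ, (∀ r ∈ S, ‖r‖ < 1) →
      HasSum (fun k : ℕ => (S.map fun r => r ^ (k + 1)).sum / ((k + 1 : ℕ) : ℂ))
        (S.map fun r => -Complex.log (1 - r)).sum := by
    intro S
    induction S using Multiset.induction_on with
    | empty => intro _; simp
    | cons a S ih =>
      intro hS
      simp only [Multiset.map_cons, Multiset.sum_cons, add_div]
      refine HasSum.add ?_ (ih fun r hr => hS r (Multiset.mem_cons_of_mem hr))
      have := Complex.hasSum_taylorSeries_neg_log (hS a (Multiset.mem_cons_self a S))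
      -- The term at index 0 is a division by zero, hence 0, so the series may start at 1.
      rw [← hasSum_nat_add_iff' 1] at this
      simpa using this
  -- Comparing exponentials makes the choice of branches irrelevant: the sum of the complex
  -- logarithms need not be a principal logarithm of the product.
  have hexp : ∀ S : Multiset ℂ, (∀ r ∈ S, ‖r‖ < 1) →
      Complex.exp (-(S.map fun r => -Complex.log (1 - r)).sum) = (S.map fun r => 1 - r).prod := by
    intro S
    induction S using Multiset.induction_on with
    | empty => intro _; simp
    | cons a S ih =>
      intro hS
      have ha : 1 - a ≠ 0 := by
        intro h0
        have : a = 1 := by linear_combination -h0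
        have h1 := hS a (Multiset.mem_cons_self a S)
        simp [this] at h1
      simp only [Multiset.map_cons, Multiset.sum_cons, Multiset.prod_cons, neg_add, neg_neg]
      rw [Complex.exp_add, Complex.exp_log ha, ih fun r hr => hS r (Multiset.mem_cons_of_mem hr)]
  have hpow : ∀ k : ℕ, (R.map fun r => r ^ k).sum = (((A ^ k).trace : ℝ) : ℂ) := by
    intro k
    rw [← trace_pow_eq_sum_roots, hM]
    rw [← Matrix.map_pow A (algebraMap ℝ ℂ) k]
    simp [trace]
  have hdet : (((1 - A).det : ℝ) : ℂ) = (R.map fun r => 1 - r).prod := by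
    have := det_aeval_eq_prod_roots M (1 - X)
    simp only [map_sub, map_one, aeval_X, eval_sub, eval_one, eval_X] at this
    rw [← this]
    have h2 := RingHom.map_det (algebraMap ℝ ℂ) (1 - A)
    rw [Complex.coe_algebraMap] at h2
    rw [h2, map_sub, map_one]
    rfl
  have h1 := hsum R hlt
  simp only [hpow] at h1
  have h2 := Complex.hasSum_re h1
  have h3 := Complex.hasSum_im h1
  set σ := (R.map fun r => -Complex.log (1 - r)).sum with hσ
  -- The terms of the series are traces of real matrices over integers, so the limit is real; the
  -- determinant is then the exponential of a real number.
  have him : σ.im = 0 := by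
    refine h3.unique ?_
    convert! hasSum_zero with k
    rw [← Complex.ofReal_natCast, ← Complex.ofReal_div, Complex.ofReal_im]
  have hre : σ = (σ.re : ℂ) := Complex.ext rfl (by simpa using him)
  have hd : Real.exp (-σ.re) = (1 - A).det := by
    have := hexp R hlt
    rw [← hσ, ← hdet, hre] at this
    exact_mod_cast this
  refine ⟨hd ▸ Real.exp_pos _, ?_⟩
  rw [← hd, Real.log_exp, neg_neg]
  convert! h2 with k
  rw [← Complex.ofReal_natCast, ← Complex.ofReal_div, Complex.ofReal_re]

end Matrix

/-! ### Formal resolvents and rank-one perturbations -/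

namespace Matrix

open PowerSeries

variable {ι : Type*} [Fintype ι] [DecidableEq ι]

/-- The generating function of the powers of `M`. -/
noncomputable def powGen (M : Matrix ι ι ℝ) : Matrix ι ι ℝ⟦X⟧ :=
  Matrix.of fun x y => PowerSeries.mk fun k => (M ^ k) x y

theorem powGen_eq (M : Matrix ι ι ℝ) :
    M.powGen = 1 + (X : ℝ⟦X⟧) • (M.powGen * M.map (C (R := ℝ))) := by
  ext x y k
  cases k with
  | zero =>
    simp [powGen, Matrix.one_apply]
  | succ k =>
    simp [powGen, Matrix.one_apply, pow_succ, Matrix.mul_apply, coeff_succ_X_mul,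
      apply_ite (PowerSeries.coeff (R := ℝ) (k + 1)), PowerSeries.coeff_one]

/-- This makes `powGen` the resolvent of `M` over formal power series, where no convergence is
involved. -/
theorem powGen_mul (M : Matrix ι ι ℝ) :
    M.powGen * (1 - (X : ℝ⟦X⟧) • M.map (C (R := ℝ))) = 1 := by
  rw [mul_sub, mul_one, Matrix.mul_smul, sub_eq_iff_eq_add]
  exact M.powGen_eq

theorem mul_powGen (M : Matrix ι ι ℝ) :
    (1 - (X : ℝ⟦X⟧) • M.map (C (R := ℝ))) * M.powGen = 1 :=
  mul_eq_one_comm.1 M.powGen_mul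

/-- The return series `∑ k, (r L ^ k e) z ^ (k + 1)`. -/
noncomputable def returnSeries (L : Matrix ι ι ℝ) (e r : ι → ℝ) : ℝ⟦X⟧ :=
  X * PowerSeries.mk fun k => r ⬝ᵥ (L ^ k *ᵥ e)

/-- The logarithmic derivative of det(1 - zM) = det(1 - zL)(1 - F(z)) for M = L + e r, with the
denominator 1 - F cleared. It comes from the resolvent identity. -/
theorem trace_powGen_sub (L : Matrix ι ι ℝ) (e r : ι → ℝ) :
    ((L + vecMulVec e r).powGen.trace - L.powGen.trace) * (1 - returnSeries L e r) =
      X * d⁄dX ℝ (returnSeries L e r) := by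
  set c : ℝ →+* ℝ⟦X⟧ := C (R := ℝ)
  set e' : ι → ℝ⟦X⟧ := fun x => c (e x)
  set r' : ι → ℝ⟦X⟧ := fun x => c (r x)
  set RL := L.powGen
  set RM := (L + vecMulVec e r).powGen
  set F := returnSeries L e r with hFdef
  have hF : F = X * (r' ⬝ᵥ (RL *ᵥ e')) := by
    rw [hFdef, returnSeries]
    congr 1
    ext k
    simp [dotProduct, mulVec, RL, powGen, e', r', c, Finset.mul_sum]
  have hM : (L + vecMulVec e r).map c = L.map c + vecMulVec e' r' := by
    ext x y : 2
    simp [vecMulVec_apply, e', r']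
  -- The resolvent identity: insert (1 - zL) RL = 1 after `RM` and write 1 - zL as (1 - zM) + z e r.
  have hres : RM = RL + (X : ℝ⟦X⟧) • (RM * vecMulVec e' r' * RL) := by
    have h1 := powGen_mul (L + vecMulVec e r)
    have h2 := mul_powGen L
    rw [hM] at h1
    calc RM = RM * ((1 - (X : ℝ⟦X⟧) • L.map c) * RL) := by rw [h2, mul_one]
      _ = RM * (1 - (X : ℝ⟦X⟧) • (L.map c + vecMulVec e' r')) * RL
          + (X : ℝ⟦X⟧) • (RM * vecMulVec e' r' * RL) := by
        simp only [smul_add, mul_sub, mul_add, sub_mul, add_mul, mul_one, Matrix.mul_smul, Matrix.smul_mul,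
          ← mul_assoc]
        abel
      _ = _ := by rw [h1, one_mul]
  have hRMe : (1 - F) • (RM *ᵥ e') = RL *ᵥ e' := by
    have : RM *ᵥ e' = RL *ᵥ e' + F • (RM *ᵥ e') := by
      conv_lhs => rw [hres]
      rw [add_mulVec, smul_mulVec, mul_assoc, ← mulVec_mulVec, ← mulVec_mulVec,
        vecMulVec_mulVec, hF]
      simp [mulVec_smul, smul_smul]
    rw [sub_smul, one_smul, sub_eq_iff_eq_add]
    exact this
  -- The square of the resolvent has coefficients (k + 1) L^k, which is what differentiating F
  -- produces.
  have hsq : (r' ᵥ* RL) ⬝ᵥ (RL *ᵥ e') = d⁄dX ℝ F := by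
    rw [← dotProduct_mulVec, mulVec_mulVec]
    ext k
    rw [PowerSeries.coeff_derivative, hFdef, returnSeries, coeff_succ_X_mul, PowerSeries.coeff_mk]
    have : ∀ x y, PowerSeries.coeff k ((RL * RL) x y) = (k + 1) * (L ^ k) x y := by
      intro x y
      rw [mul_apply, map_sum]
      simp only [PowerSeries.coeff_mul, RL, powGen, of_apply, PowerSeries.coeff_mk]
      rw [Finset.sum_comm]
      have : ∀ p ∈ Finset.HasAntidiagonal.antidiagonal k, ∑ z, (L ^ p.1) x z * (L ^ p.2) z y = (L ^ k) x y := by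
        intro p hp
        rw [← mul_apply, ← pow_add, Finset.HasAntidiagonal.mem_antidiagonal.1 hp]
      rw [Finset.sum_congr rfl this]
      simp
    simp only [dotProduct, mulVec, map_sum, r', e', c, PowerSeries.coeff_C_mul,
      PowerSeries.coeff_mul_C, this, Finset.mul_sum, Finset.sum_mul]
    refine Finset.sum_congr rfl fun x _ => Finset.sum_congr rfl fun y _ => ?_
    ring
  have htr : RM.trace - RL.trace = X * ((r' ᵥ* RL) ⬝ᵥ (RM *ᵥ e')) := by
    conv_lhs => rw [hres]
    rw [trace_add, add_sub_cancel_left, trace_smul, mul_assoc, vecMulVec_mul, mul_vecMulVec,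
      trace_vecMulVec, dotProduct_comm, smul_eq_mul]
  rw [htr, ← hsq, ← hRMe, dotProduct_smul, smul_eq_mul]
  ring

/-- Expanding z F' / (1 - F) geometrically gives terms z F' F^s = z (F^(s+1))' / (s + 1). Their
coefficients at z^k carry a factor k, which cancels the denominator. -/
theorem trace_add_vecMulVec_pow (L : Matrix ι ι ℝ) (e r : ι → ℝ) {k : ℕ} (hk : 1 ≤ k) :
    ((L + vecMulVec e r) ^ k).trace / k = (L ^ k).trace / k +
      ∑ s ∈ Finset.range k, PowerSeries.coeff k (returnSeries L e r ^ (s + 1)) / (s + 1) := by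
  set F := returnSeries L e r with hF
  set T := (L + vecMulVec e r).powGen.trace - L.powGen.trace with hT
  have hco : ∀ k, PowerSeries.coeff k T = ((L + vecMulVec e r) ^ k).trace - (L ^ k).trace := by
    intro k
    simp [hT, trace, powGen]
  have key : T * (1 - F) = X * d⁄dX ℝ F := trace_powGen_sub L e r
  have hexp : ∀ m : ℕ, T = ∑ s ∈ Finset.range m, X * d⁄dX ℝ F * F ^ s + T * F ^ m := by
    intro m
    induction m with
    | zero => simp
    | succ m ih =>
      rw [Finset.sum_range_succ, ← key]
      conv_lhs => rw [ih, ← key]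
      ring
  have hs : ∀ s : ℕ, PowerSeries.coeff (R := ℝ) k (X * d⁄dX ℝ F * F ^ s) =
      k * (PowerSeries.coeff k (F ^ (s + 1)) / (s + 1)) := by
    intro s
    have h1 : X * d⁄dX ℝ (F ^ (s + 1)) = (s + 1 : ℝ) • (X * d⁄dX ℝ F * F ^ s) := by
      rw [Derivation.leibniz_pow]
      simp only [Nat.add_sub_cancel, smul_eq_mul, nsmul_eq_mul, Algebra.smul_def]
      simp
      ring
    have h2 := congrArg (PowerSeries.coeff k) h1
    obtain ⟨k, rfl⟩ : ∃ k', k = k' + 1 := ⟨k - 1, by omega⟩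
    rw [coeff_succ_X_mul, PowerSeries.coeff_derivative, PowerSeries.coeff_smul, smul_eq_mul] at h2
    have : (s + 1 : ℝ) ≠ 0 := by positivity
    push_cast
    field_simp
    linear_combination -h2
  -- Neither `T` nor `F` has a constant term, so the remainder of the geometric expansion starts at
  -- degree `k + 1`.
  have hz : PowerSeries.coeff k (T * F ^ k) = 0 := by
    have hT0 : PowerSeries.coeff 0 T = 0 := by rw [hco]; simp
    obtain ⟨T', hT'⟩ := PowerSeries.X_dvd_iff.2 (by simpa using hT0)
    have h1 : T * F ^ k = X ^ (k + 1) * (T' * (PowerSeries.mk fun k => r ⬝ᵥ (L ^ k *ᵥ e)) ^ k) := by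
      rw [hT', hF, returnSeries]
      ring
    rw [h1, PowerSeries.coeff_X_pow_mul']
    simp
  have h := congrArg (PowerSeries.coeff k) (hexp k)
  rw [map_add, hz, add_zero, map_sum, Finset.sum_congr rfl fun s _ => hs s, ← Finset.mul_sum,
    hco] at h
  have : (k : ℝ) ≠ 0 := by positivity
  field_simp
  linear_combination h

end Matrix

/-! ### Sums over words -/

open Classical in
/-- The words with `s` letters and total length `k`, where `L m` is the set of the letters of
length `m`. -/
noncomputable def wordFinset {γ : Type*} (L : ℕ → Finset γ) : ℕ → ℕ → Finset (List γ)
  | 0, k => if k = 0 then {[]} else ∅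
  | s + 1, k => (Finset.HasAntidiagonal.antidiagonal k).biUnion fun p =>
      (L p.1 ×ˢ wordFinset L s p.2).image fun x => x.1 :: x.2

section Words

variable {γ : Type*} {Q : Set γ} {len : γ → ℕ} {L : ℕ → Finset γ}

theorem mem_wordFinset (hL : ∀ m q, q ∈ L m ↔ q ∈ Q ∧ len q = m) {s k : ℕ} {W : List γ} :
    W ∈ wordFinset L s k ↔ W.length = s ∧ (∀ q ∈ W, q ∈ Q) ∧ (W.map len).sum = k := by
  induction s generalizing k W with
  | zero =>
    by_cases hk : k = 0
    · simp only [wordFinset, hk, if_true, Finset.mem_singleton]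
      constructor
      · rintro rfl; simp
      · rintro ⟨h, -⟩; exact List.length_eq_zero_iff.1 h
    · simp only [wordFinset, hk, if_false, Finset.notMem_empty, false_iff]
      rintro ⟨h, -, h'⟩
      rw [List.length_eq_zero_iff] at h
      subst h
      exact hk (by simpa using h'.symm)
  | succ s ih =>
    simp only [wordFinset, Finset.mem_biUnion, Finset.mem_image, Finset.mem_product, Prod.exists,
      Finset.HasAntidiagonal.mem_antidiagonal, ih, hL]
    constructor
    · rintro ⟨a, b, rfl, q, W, ⟨⟨hq, rfl⟩, rfl, hW, rfl⟩, rfl⟩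
      simpa using ⟨hq, hW⟩
    · cases W with
      | nil => simp
      | cons q W =>
        simp only [List.length_cons, List.mem_cons, forall_eq_or_imp, List.map_cons, List.sum_cons]
        rintro ⟨hs, ⟨hq, hW⟩, hk⟩
        exact ⟨len q, (W.map len).sum, hk, q, W, ⟨⟨hq, rfl⟩, by omega, hW, rfl⟩, rfl⟩

-- Splitting off the first letter turns concatenation into the Cauchy product of the
-- length-generating series.
open Classical in
theorem sum_wordFinset (hL : ∀ m q, q ∈ L m ↔ q ∈ Q ∧ len q = m) (v : γ → ℝ) (s k : ℕ) :
    ∑ W ∈ wordFinset L s k, (W.map v).prod =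
      PowerSeries.coeff k ((PowerSeries.mk fun m => ∑ q ∈ L m, v q) ^ s) := by
  induction s generalizing k with
  | zero =>
    rw [pow_zero, PowerSeries.coeff_one]
    by_cases hk : k = 0 <;> simp [wordFinset, hk]
  | succ s ih =>
    rw [pow_succ', PowerSeries.coeff_mul, wordFinset, Finset.sum_biUnion]
    · refine Finset.sum_congr rfl fun p _ => ?_
      rw [Finset.sum_image, Finset.sum_product, ← ih, PowerSeries.coeff_mk, Finset.sum_mul]
      · refine Finset.sum_congr rfl fun q _ => ?_
        rw [Finset.mul_sum]
        simp
      · intro x _ y _ h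
        simpa [Prod.ext_iff] using h
    · intro p _ p' _ hpp
      refine Finset.disjoint_left.2 fun W h h' => hpp ?_
      simp only [Finset.mem_image, Finset.mem_product, Prod.exists, hL, mem_wordFinset hL] at h h'
      obtain ⟨q, W, ⟨⟨-, h1⟩, -, -, h2⟩, rfl⟩ := h
      obtain ⟨q', W', ⟨⟨-, h1'⟩, -, -, h2'⟩, h⟩ := h'
      obtain ⟨rfl, rfl⟩ := List.cons.inj h
      exact Prod.ext (h1.symm.trans h1') (h2.symm.trans h2')

/-- Letters have positive length, so words of total length `k` have at most `k` letters, and at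
least one as `k ≥ 1`. The index `s` stands for `s + 1` letters. -/
theorem finsum_words_div_length (hL : ∀ m q, q ∈ L m ↔ q ∈ Q ∧ len q = m) (hpos : L 0 = ∅)
    (v : γ → ℝ) {k : ℕ} (hk : 1 ≤ k) :
    {W : List γ | (∀ q ∈ W, q ∈ Q) ∧ (W.map len).sum = k}.Finite ∧
    ∑ᶠ W ∈ {W : List γ | (∀ q ∈ W, q ∈ Q) ∧ (W.map len).sum = k}, (W.map v).prod / W.length =
      ∑ s ∈ Finset.range k,
        PowerSeries.coeff k ((PowerSeries.mk fun m => ∑ q ∈ L m, v q) ^ (s + 1)) / (s + 1) := by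
  classical
  have hlen : ∀ q ∈ Q, 1 ≤ len q := by
    intro q hq
    by_contra h
    have : q ∈ L 0 := (hL 0 q).2 ⟨hq, by omega⟩
    simp [hpos] at this
  have hset : {W : List γ | (∀ q ∈ W, q ∈ Q) ∧ (W.map len).sum = k} =
      ((Finset.range k).biUnion fun s => wordFinset L (s + 1) k : Finset (List γ)) := by
    ext W
    simp only [Set.mem_ofPred_eq, Finset.coe_biUnion, Set.mem_iUnion, Finset.mem_coe,
      Finset.mem_range, mem_wordFinset hL, exists_prop]
    constructor
    · rintro ⟨hQ, rfl⟩
      have h1 : W.length ≤ (W.map len).sum := by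
        have := List.length_le_sum_of_one_le (W.map len) (by
          intro m hm
          obtain ⟨q, hq, rfl⟩ := List.mem_map.1 hm
          exact hlen q (hQ q hq))
        simpa using this
      have h2 : W.length ≠ 0 := by
        intro h0
        rw [List.length_eq_zero_iff] at h0
        subst h0
        simp at hk
      exact ⟨W.length - 1, by omega, by omega, hQ, rfl⟩
    · rintro ⟨s, -, -, hQ, h⟩
      exact ⟨hQ, h⟩
  rw [hset]
  refine ⟨Finset.finite_toSet _, ?_⟩
  rw [finsum_mem_coe_finset, Finset.sum_biUnion]
  · refine Finset.sum_congr rfl fun s _ => ?_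
    rw [← sum_wordFinset hL, Finset.sum_div]
    refine Finset.sum_congr rfl fun W hW => ?_
    rw [((mem_wordFinset hL).1 hW).1]
    push_cast
    rfl
  · intro s _ s' _ hss
    refine Finset.disjoint_left.2 fun W h h' => hss ?_
    have h1 := ((mem_wordFinset hL).1 h).1
    have h2 := ((mem_wordFinset hL).1 h').1
    omega

end Words

/-! ### Sums over walks -/

theorem finsum_mem_list_eq_finsum_cons {γ : Type*} {S : Set (List γ)} (hS : S.Finite)
    (hne : ∀ l ∈ S, l ≠ []) (f : List γ → ℝ) :
    ∑ᶠ l ∈ S, f l = ∑ᶠ a, ∑ᶠ l ∈ {l | a :: l ∈ S}, f (a :: l) := by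
  have hfin : ∀ a, {l | a :: l ∈ S}.Finite := fun a =>
    hS.preimage (List.cons_injective (a := a)).injOn
  have hA : {a | ∃ l, a :: l ∈ S}.Finite := by
    refine ((hS.image List.head?).preimage (Option.some_injective γ).injOn).subset ?_
    rintro a ⟨l, hl⟩
    exact ⟨_, hl, rfl⟩
  have hU : S = ⋃ a ∈ {a | ∃ l, a :: l ∈ S}, (List.cons a) '' {l | a :: l ∈ S} := by
    ext l
    simp only [Set.mem_iUnion, Set.mem_ofPred_eq, Set.mem_image, exists_prop]
    constructor
    · intro hl
      obtain ⟨a, l, rfl⟩ := List.exists_cons_of_ne_nil (hne l hl)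
      exact ⟨a, ⟨l, hl⟩, l, hl, rfl⟩
    · rintro ⟨a, -, l, hl, rfl⟩
      exact hl
  conv_lhs => rw [hU]
  rw [finsum_mem_biUnion _ hA fun a _ => (hfin a).image _]
  · rw [finsum_mem_congr rfl fun a _ => finsum_mem_image (List.cons_injective (a := a)).injOn]
    rw [← finsum_mem_univ fun a => ∑ᶠ l ∈ {l | a :: l ∈ S}, f (a :: l)]
    refine finsum_mem_inter_support_eq _ _ _ ?_
    ext a
    simp only [Set.mem_inter_iff, Set.mem_univ, true_and, and_iff_right_iff_imp,
      Set.mem_ofPred_eq, Function.mem_support]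
    intro h
    by_contra h0
    refine h ?_
    exact finsum_mem_eq_zero_of_forall_eq_zero fun l hl => (h0 ⟨l, hl⟩).elim
  · intro a _ b _ hab
    refine Set.disjoint_left.2 ?_
    rintro _ ⟨l, -, rfl⟩ ⟨l', -, h⟩
    exact hab (List.cons.inj h).1.symm

namespace Arc

/-- An arc is a triple. -/
def equivProd (α β : Type*) : Arc α β ≃ α × β × α where
  toFun a := ⟨a.tail, a.edge, a.head⟩
  invFun p := ⟨p.1, p.2.1, p.2.2⟩
  left_inv _ := rfl
  right_inv _ := rfl

noncomputable instance {α β : Type*} [Fintype α] [Fintype β] : Fintype (Arc α β) :=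
  Fintype.ofEquiv _ (equivProd α β).symm

theorem sum_eq {α β : Type*} [Fintype α] [Fintype β] (f : Arc α β → ℝ) :
    ∑ a, f a = ∑ x, ∑ y, ∑ e, f ⟨x, e, y⟩ := by
  rw [Fintype.sum_equiv (equivProd α β) f (fun p => f ⟨p.1, p.2.1, p.2.2⟩) fun _ => rfl,
    Fintype.sum_prod_type]
  exact Finset.sum_congr rfl fun x _ => Fintype.sum_prod_type_right _

end Arc

namespace WeightedMultigraph

variable {α β : Type*}

/-- The walks of length `m + 1` from `x` to `y` whose internal vertices lie in `N`. -/
def innerWalks (H : WeightedMultigraph α β) (N : Set α) (x y : α) (m : ℕ) :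
    Set (List (Arc α β)) :=
  {l | H.IsWalk x l y ∧ l.length = m + 1 ∧ ∀ a ∈ l.tail, a.tail ∈ N}

theorem finite_innerWalks [Finite α] [Finite β] (H : WeightedMultigraph α β) (N : Set α) (x y : α)
    (m : ℕ) : (H.innerWalks N x y m).Finite := by
  have := Fintype.ofFinite α
  have := Fintype.ofFinite β
  exact (List.finite_length_eq (Arc α β) (m + 1)).subset fun l hl => hl.2.1

-- Splitting off the first arc gives a transfer-matrix induction: the diagonal factor forces each of
-- the `m` internal vertices into `N`, while the ends `x` and `y` stay unrestricted.
open Classical in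
theorem finsum_innerWalks [DecidableEq α] [Fintype α] [Fintype β] (H : WeightedMultigraph α β) (N : Set α)
    [DecidablePred (· ∈ N)] (x y : α) (m : ℕ) :
    ∑ᶠ l ∈ H.innerWalks N x y m, H.walkWeight l =
      (H.adjMatrix * (Matrix.diagonal (fun v => if v ∈ N then (1 : ℝ) else 0) * H.adjMatrix) ^ m :
        Matrix α α ℝ) x y := by
  have hne : ∀ x m, ∀ l ∈ H.innerWalks N x y m, l ≠ [] := by
    rintro x m l ⟨-, h, -⟩ rfl
    simp at h
  induction m generalizing x with
  | zero =>
    rw [finsum_mem_list_eq_finsum_cons (H.finite_innerWalks N x y 0) (hne x 0),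
      finsum_eq_sum_of_fintype]
    have : ∀ a : Arc α β, ∑ᶠ l ∈ {l | a :: l ∈ H.innerWalks N x y 0}, H.walkWeight (a :: l) =
        if a.tail = x then if a.head = y then if H.IsLink a.edge x y then H.weight a.edge else 0
        else 0 else 0 := by
      intro a
      by_cases h : a.tail = x ∧ a.head = y ∧ H.IsLink a.edge x y
      · have hs : {l | a :: l ∈ H.innerWalks N x y 0} = {[]} := by
          ext l
          simp only [innerWalks, IsWalk, Set.mem_ofPred_eq, List.length_cons, List.tail_cons,
            Set.mem_singleton_iff]
          constructor
          · rintro ⟨-, h, -⟩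
            exact List.length_eq_zero_iff.1 (by omega)
          · rintro rfl
            simpa [IsWalk, h.1, h.2.1, h.2.2] using h.2.2.right_mem
        rw [hs, finsum_mem_singleton]
        simp [walkWeight, h]
      · have hs : {l | a :: l ∈ H.innerWalks N x y 0} = ∅ := by
          refine Set.eq_empty_of_forall_notMem ?_
          rintro l ⟨h1, h2, -⟩
          have : l = [] := List.length_eq_zero_iff.1 (by simpa using h2)
          subst this
          obtain ⟨rfl, h3, -, rfl⟩ := h1
          exact h ⟨rfl, rfl, h3⟩
        rw [hs, finsum_mem_empty]
        split_ifs <;> simp_all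
    rw [Fintype.sum_congr _ _ this, Arc.sum_eq]
    simp [adjMatrix]
  | succ m ih =>
    rw [finsum_mem_list_eq_finsum_cons (H.finite_innerWalks N x y (m + 1)) (hne x (m + 1)),
      finsum_eq_sum_of_fintype]
    have : ∀ a : Arc α β, ∑ᶠ l ∈ {l | a :: l ∈ H.innerWalks N x y (m + 1)},
        H.walkWeight (a :: l) =
        if a.tail = x then if a.head ∈ N then if H.IsLink a.edge x a.head then
          H.weight a.edge * ∑ᶠ l ∈ H.innerWalks N a.head y m, H.walkWeight l else 0
        else 0 else 0 := by
      intro a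
      by_cases h : a.tail = x ∧ a.head ∈ N ∧ H.IsLink a.edge x a.head
      · have hs : {l | a :: l ∈ H.innerWalks N x y (m + 1)} = H.innerWalks N a.head y m := by
          ext l
          simp only [innerWalks, IsWalk, Set.mem_ofPred_eq, List.length_cons, List.tail_cons,
            h.1, h.2.2, true_and, Nat.add_right_cancel_iff]
          refine and_congr_right fun h1 => and_congr_right fun h2 => ?_
          cases l with
          | nil => simp
          | cons b l => simp [h1.1, h.2.1]
        rw [hs, if_pos h.1, if_pos h.2.1, if_pos h.2.2,
          mul_finsum_mem' _ _ (H.finite_innerWalks N a.head y m)]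
        simp [walkWeight]
      · have hs : {l | a :: l ∈ H.innerWalks N x y (m + 1)} = ∅ := by
          refine Set.eq_empty_of_forall_notMem ?_
          rintro l ⟨h1, h2, h3⟩
          obtain ⟨rfl, h4, h5⟩ := h1
          cases l with
          | nil => simp at h2
          | cons b l => exact h ⟨rfl, h5.1 ▸ h3 b (by simp), h4⟩
        rw [hs, finsum_mem_empty]
        split_ifs <;> simp_all
    have hstep : H.adjMatrix * (Matrix.diagonal (fun v => if v ∈ N then 1 else 0) * H.adjMatrix) ^
        (m + 1) = H.adjMatrix * (Matrix.diagonal (fun v => if v ∈ N then (1 : ℝ) else 0) *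
          (H.adjMatrix * (Matrix.diagonal (fun v => if v ∈ N then 1 else 0) * H.adjMatrix) ^ m)) := by
      rw [pow_succ']
      simp only [Matrix.mul_assoc]
    rw [Fintype.sum_congr _ _ this, Arc.sum_eq, hstep, Matrix.mul_apply]
    rw [Fintype.sum_eq_single x]
    · refine Finset.sum_congr rfl fun z _ => ?_
      rw [Matrix.diagonal_mul, ← ih z, adjMatrix, Matrix.of_apply]
      by_cases hz : z ∈ N
      · simp [hz, Finset.sum_mul, ite_mul]
      · simp [hz]
    · intro z hz
      simp [hz]

end WeightedMultigraph

/-! ### The matrix 1 - B_(ij) T_(ji) as a rank-one perturbation -/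

namespace Matrix

variable {n : ℕ}

theorem oneWithNeg_eq_transvection {i j : Fin (n + 1)} :
    oneWithNeg i j = 1 + single i j ((-1 : ℝ) - (1 : Matrix (Fin (n + 1)) (Fin (n + 1)) ℝ) i j) := by
  ext x y
  by_cases hx : x = i
  · subst hx
    by_cases hy : y = j
    · subst hy; simp [oneWithNeg]
    · simp [oneWithNeg, hy, Ne.symm hy]
  · simp [oneWithNeg, hx, Ne.symm hx]

/-- Up to the sign (-1)^(i+j), which evenness removes, this minor is an entry of the adjugate of a
transvection. The adjugate is the inverse transvection, whose entry at `i, j` is 1. -/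
theorem det_transfer {i j : Fin (n + 1)} (hij : j ≠ i) (heven : Even ((i : ℕ) + (j : ℕ))) :
    (transfer j i).det = 1 := by
  have hT : oneWithNeg i j = transvection i j (-1 : ℝ) := by
    rw [oneWithNeg_eq_transvection, transvection, one_apply_ne hij.symm, sub_zero]
  have hadj : adjugate (transvection i j (-1 : ℝ)) = transvection i j 1 := by
    have h1 : transvection i j (-1 : ℝ) * transvection i j 1 = 1 := by
      rw [transvection_mul_transvection_same (h := hij.symm)]; simp
    calc adjugate (transvection i j (-1 : ℝ))
        = adjugate (transvection i j (-1 : ℝ)) * (transvection i j (-1 : ℝ) * transvection i j 1) := by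
          rw [h1, mul_one]
      _ = _ := by rw [← mul_assoc, adjugate_mul, det_transvection_of_ne _ _ hij.symm]; simp
  have h := adjugate_fin_succ_eq_det_submatrix (oneWithNeg i j) i j
  rw [hT, hadj] at h
  have heven' : Even ((j : ℕ) + (i : ℕ)) := by rwa [add_comm]
  rw [heven'.neg_one_pow, one_mul] at h
  rw [transfer, removeRowCol, hT, ← h]
  simp [transvection, hij.symm]

/-- The indicator of the complement of `{i, j}`, as a diagonal matrix. -/
noncomputable def avoid (i j : Fin (n + 1)) : Matrix (Fin (n + 1)) (Fin (n + 1)) ℝ :=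
  diagonal fun v => if v ∈ ({i, j} : Set (Fin (n + 1)))ᶜ then 1 else 0

/-- The matrix `avoid i j` with the entry at `i, j` replaced by `-1`. -/
noncomputable def redirect (i j : Fin (n + 1)) : Matrix (Fin (n + 1)) (Fin (n + 1)) ℝ :=
  avoid i j - single i j 1

/-- The matrix `1 - B_(ij) T_(ji)` for `B = 1 - A`, with a zero row and a zero column at `i`. -/
noncomputable def transit (A : Matrix (Fin (n + 1)) (Fin (n + 1)) ℝ) (i j : Fin (n + 1)) :
    Matrix (Fin (n + 1)) (Fin (n + 1)) ℝ :=
  avoid i j * A * redirect i j +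
    vecMulVec (Pi.single j 1) ((A * redirect i j) j + Pi.single j 1)

variable (A : Matrix (Fin (n + 1)) (Fin (n + 1)) ℝ) {i j : Fin (n + 1)}

theorem mul_redirect_apply (hij : j ≠ i) (x y : Fin (n + 1)) :
    (A * redirect i j) x y = if y = i then 0 else if y = j then -A x i else A x y := by
  rw [redirect, avoid, mul_sub, sub_apply, mul_diagonal]
  by_cases hj : y = j
  · subst hj; simp [hij]
  · by_cases hi : y = i
    · subst hi; simp [hj]
    · simp [hi, hj]

theorem transit_apply_left (hij : j ≠ i) (y : Fin (n + 1)) : transit A i j i y = 0 := by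
  rw [transit, mul_assoc, avoid, add_apply, diagonal_mul]
  simp [vecMulVec_apply, hij.symm]

theorem transit_apply (hij : j ≠ i) {x y : Fin (n + 1)} (hx : x ≠ i) (hy : y ≠ i) :
    transit A i j x y =
      if y = j then (1 : Matrix (Fin (n + 1)) (Fin (n + 1)) ℝ) x j - A x i else A x y := by
  rw [transit, mul_assoc, avoid, add_apply, diagonal_mul, vecMulVec_apply, Pi.add_apply,
    mul_redirect_apply A hij, mul_redirect_apply A hij]
  by_cases hxj : x = j
  · subst hxj
    by_cases hyj : y = x
    · subst hyj; simp [hij]; ring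
    · simp [hyj, hy]
  · by_cases hyj : y = j
    · subst hyj; simp [hij, hxj, hx]
    · simp [hyj, hy, hxj, hx]

theorem one_sub_mul_transfer (hij : j ≠ i) :
    1 - (1 - A).removeRowCol i j * transfer j i =
      (transit A i j).submatrix i.succAbove i.succAbove := by
  ext x y
  have hx := Fin.succAbove_ne i x
  have hy := Fin.succAbove_ne i y
  rw [submatrix_apply, transit_apply A hij hx hy, sub_apply, mul_apply]
  -- The product of the reduced matrices is the full product with I(i,j) minus the summand at the
  -- deleted index `j`.
  have h := Fin.sum_univ_succAbove (fun v => (1 - A) (i.succAbove x) v *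
    oneWithNeg i j v (i.succAbove y)) j
  simp only [removeRowCol, transfer, submatrix_apply]
  rw [← sub_eq_iff_eq_add'] at h
  rw [← h, ← mul_apply, oneWithNeg_eq_transvection, one_apply_ne hij.symm, sub_zero, mul_add, mul_one]
  have hone : (1 : Matrix (Fin n) (Fin n) ℝ) x y =
      (1 : Matrix (Fin (n + 1)) (Fin (n + 1)) ℝ) (i.succAbove x) (i.succAbove y) := by
    simp [one_apply]
  rw [hone]
  by_cases hyj : i.succAbove y = j
  · rw [hyj]
    simp [one_apply_ne hx, hij.symm]
  · simp [hyj, Ne.symm hyj, hij.symm, one_apply_ne (Ne.symm hyj)]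

/-- A zero row at `i` persists in all positive powers, so the index `i` contributes neither to
products nor to traces. The zeroth power has to be excluded. -/
theorem trace_submatrix_succAbove_pow {M : Matrix (Fin (n + 1)) (Fin (n + 1)) ℝ}
    (hM : ∀ y, M i y = 0) (k : ℕ) :
    ((M.submatrix i.succAbove i.succAbove) ^ (k + 1)).trace = (M ^ (k + 1)).trace := by
  have hrow : ∀ k y, (M ^ (k + 1)) i y = 0 := by
    intro k y
    rw [pow_succ', mul_apply]
    simp [hM]
  have hsub : ∀ k, (M.submatrix i.succAbove i.succAbove) ^ (k + 1) =
      (M ^ (k + 1)).submatrix i.succAbove i.succAbove := by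
    intro k
    induction k with
    | zero => simp
    | succ k ih =>
      rw [pow_succ', ih]
      ext x y
      rw [submatrix_apply, pow_succ' M (k + 1), mul_apply, mul_apply, Fin.sum_univ_succAbove _ i, hrow]
      simp
  rw [hsub, trace, trace, Fin.sum_univ_succAbove _ i]
  simp [hrow]

theorem avoid_mul_avoid : avoid i j * avoid i j = avoid i j := by
  rw [avoid, diagonal_mul_diagonal]
  congr 1
  ext v
  split_ifs <;> simp

theorem redirect_mul_avoid : redirect i j * avoid i j = avoid i j := by
  rw [redirect, sub_mul, avoid_mul_avoid, sub_eq_self]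
  ext x y
  rw [avoid, mul_diagonal]
  by_cases hy : y = j
  · simp [hy]
  · simp [Ne.symm hy]

/-- Between consecutive factors `redirect` meets `avoid` and is absorbed by it, so only the last
copy survives. -/
theorem transit_part_pow (m : ℕ) :
    (avoid i j * A * redirect i j) ^ (m + 1) = (avoid i j * A) ^ (m + 1) * redirect i j := by
  induction m with
  | zero => simp
  | succ m ih =>
    rw [pow_succ, ih, pow_succ _ (m + 1)]
    calc _ = (avoid i j * A) ^ (m + 1) * ((redirect i j * avoid i j) * A * redirect i j) := by
          simp only [mul_assoc]
      _ = _ := by rw [redirect_mul_avoid]; simp only [mul_assoc]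

theorem trace_transit_part_pow (m : ℕ) :
    ((avoid i j * A * redirect i j) ^ (m + 1)).trace =
      ∑ x, if x ∈ ({i, j} : Set (Fin (n + 1)))ᶜ then (A * (avoid i j * A) ^ m) x x else 0 := by
  rw [transit_part_pow, trace_mul_comm, pow_succ', ← mul_assoc, ← mul_assoc, redirect_mul_avoid,
    mul_assoc, trace]
  refine Finset.sum_congr rfl fun x _ => ?_
  rw [diag_apply]
  conv_lhs => rw [avoid, diagonal_mul]
  rw [← avoid]
  split_ifs <;> simp

/-- These are the coefficients of the return series F. The 1 at `m = 0` becomes the jump; the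
subtracted entries become the excursions from `j` to `i` of length `m + 1`. -/
theorem dotProduct_transit_part_pow (hij : j ≠ i) (m : ℕ) :
    ((A * redirect i j) j + Pi.single j 1) ⬝ᵥ
        ((avoid i j * A * redirect i j) ^ m *ᵥ Pi.single j 1) =
      (if m = 0 then 1 else 0) - (A * (avoid i j * A) ^ m) j i := by
  cases m with
  | zero =>
    simp only [pow_zero, one_mulVec, dotProduct_single, Pi.add_apply, mul_redirect_apply A hij]
    simp [hij]
    ring
  | succ m =>
    -- This is where the minus sign and the end vertex `i` arise: the entry -1 of `redirect` sends
    -- e_j to -e_i.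
    have he : redirect i j *ᵥ Pi.single j 1 = -Pi.single i 1 := by
      ext x
      by_cases hx : x = i
      · subst hx; simp [redirect, avoid, diagonal_apply_ne _ hij.symm]
      · by_cases hxj : x = j
        · subst hxj; simp [redirect, avoid, hx, Ne.symm hx]
        · simp [redirect, avoid, hx, Ne.symm hx, diagonal_apply_ne _ hxj]
    have hrow : ((avoid i j * A) ^ (m + 1)) j i = 0 := by
      rw [pow_succ', mul_assoc]
      conv_lhs => rw [avoid, diagonal_mul]
      simp
    have hAZ : A * redirect i j * (avoid i j * A) ^ (m + 1) = A * (avoid i j * A) ^ (m + 1) := by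
      rw [pow_succ']
      calc _ = A * (redirect i j * avoid i j) * A * (avoid i j * A) ^ m := by
            simp only [mul_assoc]
        _ = _ := by rw [redirect_mul_avoid]; simp only [mul_assoc]
    have h1 : (A * redirect i j) j ⬝ᵥ ((avoid i j * A) ^ (m + 1) *ᵥ Pi.single i 1) =
        (A * (avoid i j * A) ^ (m + 1)) j i := by
      rw [← hAZ, mul_apply]
      simp [dotProduct]
    rw [transit_part_pow, ← mulVec_mulVec, he, mulVec_neg, dotProduct_neg, add_dotProduct, h1,
      single_dotProduct]
    simp [hrow]

/-- The traces of the powers of `1 - B_(ij) T_(ji)` through walks between `i` and `j`. -/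
theorem trace_pow_div (hij : j ≠ i) {F : PowerSeries ℝ} (hF0 : PowerSeries.coeff 0 F = 0)
    (hF : ∀ m, PowerSeries.coeff (m + 1) F =
      (if m = 0 then 1 else 0) - (A * (avoid i j * A) ^ m) j i) (k : ℕ) :
    ((1 - (1 - A).removeRowCol i j * transfer j i) ^ (k + 1)).trace / ((k + 1 : ℕ) : ℝ) =
      (∑ x, if x ∈ ({i, j} : Set (Fin (n + 1)))ᶜ then (A * (avoid i j * A) ^ k) x x else 0) /
        ((k + 1 : ℕ) : ℝ) +
      ∑ s ∈ Finset.range (k + 1), PowerSeries.coeff (k + 1) (F ^ (s + 1)) / (s + 1) := by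
  have hFr : F = returnSeries (avoid i j * A * redirect i j) (Pi.single j 1)
      ((A * redirect i j) j + Pi.single j 1) := by
    ext m
    cases m with
    | zero => rw [hF0]; simp [returnSeries]
    | succ m =>
      rw [hF, returnSeries, PowerSeries.coeff_succ_X_mul, PowerSeries.coeff_mk,
        dotProduct_transit_part_pow A hij]
  rw [one_sub_mul_transfer A hij, trace_submatrix_succAbove_pow (transit_apply_left A hij),
    transit, trace_add_vecMulVec_pow _ _ _ (Nat.le_add_left 1 k), trace_transit_part_pow, hFr]

end Matrix

namespace WeightedMultigraph

variable {α β : Type*}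

/-! ### Walks -/

section Walks

variable {H : WeightedMultigraph α β} {x y z : α} {l l' : List (Arc α β)} {a : Arc α β}

theorem IsWalk.left_mem (h : H.IsWalk x l y) : x ∈ H.vertexSet := by
  cases l with
  | nil => exact h.1
  | cons a l => exact h.1 ▸ h.2.1.left_mem

theorem isWalk_append : H.IsWalk x (l ++ l') z ↔ ∃ y, H.IsWalk x l y ∧ H.IsWalk y l' z := by
  induction l generalizing x with
  | nil =>
    constructor
    · exact fun h => ⟨x, ⟨IsWalk.left_mem h, rfl⟩, h⟩
    · rintro ⟨y, ⟨-, rfl⟩, h⟩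
      exact h
  | cons a l ih =>
    simp only [List.cons_append, IsWalk, ih]
    constructor
    · rintro ⟨h1, h2, y, h3, h4⟩
      exact ⟨y, ⟨h1, h2, h3⟩, h4⟩
    · rintro ⟨y, ⟨h1, h2, h3⟩, h4⟩
      exact ⟨h1, h2, y, h3, h4⟩

theorem IsWalk.right_mem (h : H.IsWalk x l y) : y ∈ H.vertexSet := by
  induction l generalizing x with
  | nil => exact h.2 ▸ h.1
  | cons a l ih => exact ih h.2.2

theorem IsWalk.right_unique (h : H.IsWalk x l y) (h' : H.IsWalk x l z) : y = z := by
  induction l generalizing x with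
  | nil => exact h.2.symm.trans h'.2
  | cons a l ih => exact ih h.2.2 h'.2.2

theorem IsWalk.cons_map_head (h : H.IsWalk x l y) :
    x :: l.map Arc.head = l.map Arc.tail ++ [y] := by
  induction l generalizing x with
  | nil => simp [h.2]
  | cons a l ih => simp [ih h.2.2, h.1]

theorem IsWalk.isLink (h : H.IsWalk x l y) (ha : a ∈ l) : H.IsLink a.edge a.tail a.head := by
  induction l generalizing x with
  | nil => simp at ha
  | cons b l ih =>
    rcases List.mem_cons.1 ha with rfl | ha
    · exact h.2.1
    · exact ih h.2.2 ha

theorem IsWalk.reverse (h : H.IsWalk x l y) : H.IsWalk y (l.map Arc.rev).reverse x := by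
  induction l generalizing x with
  | nil => exact ⟨h.2 ▸ h.1, h.2.symm⟩
  | cons a l ih =>
    rw [List.map_cons, List.reverse_cons, isWalk_append]
    obtain ⟨rfl, h2, h3⟩ := h
    exact ⟨_, ih h3, rfl, h2.symm, h2.left_mem, rfl⟩

theorem IsWalk.visits_right (h : H.IsWalk x l y) (hl : l ≠ []) : Visits l y := by
  have h1 : y ∈ x :: l.map Arc.head := by rw [h.cons_map_head]; simp
  rcases List.mem_cons.1 h1 with rfl | h1
  · obtain ⟨a, l, rfl⟩ := List.exists_cons_of_ne_nil hl
    exact ⟨a, by simp, Or.inl h.1⟩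
  · obtain ⟨a, ha, rfl⟩ := List.mem_map.1 h1
    exact ⟨a, ha, Or.inr rfl⟩

theorem Visits.mono {v : α} (h : Visits l v) (hl : ∀ a ∈ l, a ∈ l') : Visits l' v := by
  obtain ⟨a, ha, h⟩ := h
  exact ⟨a, hl a ha, h⟩

/-- A nonempty walk from `x` to `y` that visits `x` and `y` only at its ends. -/
def IsExcursion (H : WeightedMultigraph α β) (x y : α) (l : List (Arc α β)) : Prop :=
  H.IsWalk x l y ∧ l ≠ [] ∧ ∀ a ∈ l.tail, a.tail ≠ x ∧ a.tail ≠ y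

theorem IsExcursion.reverse (h : H.IsExcursion x y l) :
    H.IsExcursion y x (l.map Arc.rev).reverse := by
  obtain ⟨h1, h2, h3⟩ := h
  refine ⟨h1.reverse, by simpa using h2, ?_⟩
  have hrev : ((l.map Arc.rev).reverse).map Arc.tail = (l.map Arc.head).reverse := by
    rw [List.map_reverse, List.map_map]
    rfl
  have htail : ((l.map Arc.rev).reverse).tail.map Arc.tail = (l.tail.map Arc.tail).reverse := by
    rw [List.map_tail, hrev]
    have := h1.cons_map_head
    obtain ⟨a, l, rfl⟩ := List.exists_cons_of_ne_nil h2
    simp only [List.map_cons, List.cons_append, List.cons.injEq] at this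
    rw [List.map_cons, this.2]
    simp
  intro a ha
  have : a.tail ∈ (l.tail.map Arc.tail).reverse := by
    rw [← htail]
    exact List.mem_map_of_mem ha
  obtain ⟨b, hb, hba⟩ := List.mem_map.1 (List.mem_reverse.1 this)
  rw [← hba]
  exact (h3 b hb).symm

theorem reverse_map_rev_involutive (l : List (Arc α β)) :
    (((l.map Arc.rev).reverse).map Arc.rev).reverse = l := by
  rw [List.map_reverse, List.reverse_reverse, List.map_map]
  exact List.map_id l

theorem IsExcursion.tail_ne (h : H.IsExcursion x y l) (hxy : x ≠ y) (ha : a ∈ l) : a.tail ≠ y := by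
  obtain ⟨h1, h2, h3⟩ := h
  obtain ⟨b, l, rfl⟩ := List.exists_cons_of_ne_nil h2
  rcases List.mem_cons.1 ha with rfl | ha
  · rw [h1.1]; exact hxy
  · exact (h3 a ha).2

end Walks

/-! ### Jumps and alternation -/

section Jumps

variable {G : WeightedMultigraph α β} {i j : α} {x y z : α} {l l' : List (Arc α (β ⊕ α))}
  {a : Arc α (β ⊕ α)}

theorem IsJump.eq_jumpArc (ha : IsJump a) (h : (G.withJumps i j).IsLink a.edge a.tail a.head) :
    a = jumpArc a.tail ∧ (a.tail = i ∨ a.tail = j) := by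
  obtain ⟨x, e | v, y⟩ := a
  · simp [IsJump] at ha
  · obtain ⟨-, h1, h2, h3⟩ := h
    dsimp only at h1 h2 h3
    subst h2 h3
    exact ⟨rfl, h1⟩

theorem isJump_jumpArc (v : α) : IsJump (jumpArc v : Arc α (β ⊕ α)) := rfl

/-- A jump is a loop at one of the two ends. It cannot leave an internal vertex, and as first arc it
would return to `x`, so that the walk stops at `x ≠ y` or leaves `x` again. -/
theorem IsExcursion.not_isJump (h : (G.withJumps i j).IsExcursion x y l) (hxy : x ≠ y)
    (hi : i = x ∨ i = y) (hj : j = x ∨ j = y) (ha : a ∈ l) : ¬ IsJump a := by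
  intro hJ
  obtain ⟨h1, h2, h3⟩ := h
  obtain ⟨h4, h5⟩ := hJ.eq_jumpArc (h1.isLink ha)
  have h6 : a.tail = x ∨ a.tail = y := by
    rcases h5 with h5 | h5 <;> rw [h5] <;> assumption
  obtain ⟨b, l, rfl⟩ := List.exists_cons_of_ne_nil h2
  rcases List.mem_cons.1 ha with rfl | ha
  · have hh : a.head = x := by
      rw [h4]; exact h1.1
    cases l with
    | nil => exact hxy (hh.symm.trans h1.2.2.2)
    | cons c l => exact (h3 c (by simp)).1 (h1.2.2.1.trans hh)
  · rcases h6 with h6 | h6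
    · exact (h3 a ha).1 h6
    · exact (h3 a ha).2 h6

theorem IsExcursion.ne_jumpArc (h : (G.withJumps i j).IsExcursion x y l) (hxy : x ≠ y) (v : α) :
    l ≠ [jumpArc v] := by
  rintro rfl
  exact hxy (h.1.1.symm.trans h.1.2.2.2)

/-- Every subwalk of `l` from `x` to `x` visits `y` or consists of jumps. -/
def AlternatesAt (H : WeightedMultigraph α (β ⊕ α)) (x y : α) (l : List (Arc α (β ⊕ α))) : Prop :=
  ∀ s, s <:+: l → H.IsWalk x s x → Visits s y ∨ ∀ a ∈ s, IsJump a

variable {H : WeightedMultigraph α (β ⊕ α)}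

/-- A nonempty subwalk from `x` starts with an arc leaving `x`, so it cannot start inside `l'`. -/
theorem AlternatesAt.append_of_tail_ne (h : H.AlternatesAt x y l) (hl : ∀ a ∈ l', a.tail ≠ x) :
    H.AlternatesAt x y (l' ++ l) := by
  induction l' with
  | nil => exact h
  | cons a l' ih =>
    intro s hs hw
    rcases List.infix_cons_iff.1 hs with hs | hs
    · cases s with
      | nil => simp
      | cons b s =>
        obtain ⟨rfl, -⟩ := List.cons_prefix_cons.1 hs
        exact (hl b (by simp) hw.1).elim
    · exact ih (fun a ha => hl a (List.mem_cons_of_mem _ ha)) s hs hw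

theorem AlternatesAt.jump_append (h : H.AlternatesAt x y l) (v : α) :
    H.AlternatesAt x y ([jumpArc v] ++ l) := by
  intro s hs hw
  rcases List.infix_cons_iff.1 hs with hs | hs
  · cases s with
    | nil => simp
    | cons b s =>
      obtain ⟨rfl, hs'⟩ := List.cons_prefix_cons.1 hs
      obtain ⟨rfl, h2, h3⟩ := hw
      rcases h s (List.IsPrefix.isInfix hs') h3 with h4 | h4
      · exact Or.inl (h4.mono fun a ha => List.mem_cons_of_mem _ ha)
      · right
        intro a ha
        rcases List.mem_cons.1 ha with rfl | ha
        · exact isJump_jumpArc _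
        · exact h4 a ha
  · exact h s hs hw

theorem AlternatesAt.excursion_append (h : H.AlternatesAt x y l) (h' : H.IsExcursion x y l') :
    H.AlternatesAt x y (l' ++ l) := by
  obtain ⟨h1, h2, h3⟩ := h'
  obtain ⟨a, r, rfl⟩ := List.exists_cons_of_ne_nil h2
  intro s hs hw
  rcases List.infix_cons_iff.1 hs with hs | hs
  · cases s with
    | nil => simp
    | cons b s =>
      obtain ⟨rfl, t, hs⟩ := List.cons_prefix_cons.1 hs
      change s ++ t = r ++ l at hs
      -- A subwalk from the start of the excursion either contains all of it and visits `y`, or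
      -- stops at an internal vertex, which is not `x`.
      rcases List.append_eq_append_iff.1 hs with ⟨m, hm, -⟩ | ⟨m, rfl, -⟩
      · cases m with
        | nil =>
          left
          rw [List.append_nil] at hm
          subst hm
          exact h1.visits_right h2
        | cons c m =>
          subst hm
          rw [← List.cons_append, isWalk_append] at h1
          obtain ⟨y', h4, h5⟩ := h1
          have := hw.right_unique h4
          exact ((h3 c (by simp)).1 (h5.1.trans this.symm)).elim
      · left
        exact (h1.visits_right h2).mono fun a ha => by
          rw [← List.cons_append]
          exact List.mem_append_left _ ha
  · exact h.append_of_tail_ne (fun a ha => (h3 a ha).1) s hs hw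

theorem AlternatesAt.excursion_append' (h : H.AlternatesAt x y l) (h' : H.IsExcursion y x l')
    (hxy : x ≠ y) : H.AlternatesAt x y (l' ++ l) :=
  h.append_of_tail_ne fun _ ha => h'.tail_ne hxy.symm ha

theorem AlternatesAt.of_append (h : H.AlternatesAt x y (l' ++ l)) : H.AlternatesAt x y l :=
  fun s hs => h s (hs.trans (List.suffix_append l' l).isInfix)

/-! ### Uniqueness of partitions -/

theorem IsPart.ne_nil (hij : j ≠ i) {u : List (Arc α (β ⊕ α))} (h : G.IsPart i j u) : u ≠ [] := by
  rintro rfl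
  rcases h with (h | h) | ⟨h | h, -⟩
  · simp at h
  · simp at h
  · exact hij h.1.2
  · exact hij h.1.2.symm

/-- The parts form a prefix code, whence unique factorization: a jump is a single arc, and a hitting
walk is determined by its start as the walk up to the first visit to the other end. -/
theorem IsPart.eq_nil_of_append (hij : j ≠ i) {u t : List (Arc α (β ⊕ α))} (hu : G.IsPart i j u)
    (hut : G.IsPart i j (u ++ t)) : t = [] := by
  obtain ⟨a, r, rfl⟩ := List.exists_cons_of_ne_nil (hu.ne_nil hij)
  by_cases ha : IsJump a
  · have h1 : ∃ v, (a :: r) ++ t = [jumpArc v] := by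
      rcases hut with (h | h) | ⟨-, h⟩
      · exact ⟨_, h⟩
      · exact ⟨_, h⟩
      · exact (h a (by simp) ha).elim
    obtain ⟨v, h1⟩ := h1
    simp only [List.cons_append, List.cons.injEq, List.append_eq_nil_iff] at h1
    exact h1.2.2
  · have key : ∀ u, a ∈ u → G.IsPart i j u →
        (G.withJumps i j).IsHittingWalk j u i ∨ (G.withJumps i j).IsHittingWalk i u j := by
      rintro u hau ((rfl | rfl) | ⟨h, -⟩)
      · exact (ha (by rw [List.mem_singleton.1 hau]; rfl)).elim
      · exact (ha (by rw [List.mem_singleton.1 hau]; rfl)).elim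
      · exact h
    have key2 : ∀ {x y x' y' : α}, (x = x' → y = y') →
        (G.withJumps i j).IsHittingWalk x (a :: r) y →
        (G.withJumps i j).IsHittingWalk x' ((a :: r) ++ t) y' → t = [] := by
      intro x y x' y' hxy h h'
      have hx : x = x' := h.1.1.symm.trans h'.1.1
      obtain rfl := hxy hx
      subst hx
      obtain ⟨z, h1, h2⟩ := isWalk_append.1 h'.1
      obtain rfl := h.1.right_unique h1
      cases t with
      | nil => rfl
      | cons c t => exact (h'.2 c (by simp) h2.1).elim
    rcases key _ (by simp) hu with h | h <;> rcases key _ (by simp) hut with h' | h'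
    · exact key2 (fun _ => rfl) h h'
    · exact key2 (fun h => (hij h).elim) h h'
    · exact key2 (fun h => (hij h.symm).elim) h h'
    · exact key2 (fun _ => rfl) h h'

theorem IsPartition.unique (hij : j ≠ i) {P P' : List (List (Arc α (β ⊕ α)))}
    (h : G.IsPartition i j l P) (h' : G.IsPartition i j l P') : P = P' := by
  induction P generalizing l P' with
  | nil =>
    cases P' with
    | nil => rfl
    | cons u P' =>
      have h1 := h'.1.trans h.1.symm
      simp only [List.flatten_cons, List.flatten_nil, List.append_eq_nil_iff] at h1
      exact ((h'.2 u (by simp)).ne_nil hij h1.1).elim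
  | cons u P ih =>
    cases P' with
    | nil =>
      have h1 := h.1.trans h'.1.symm
      simp only [List.flatten_cons, List.flatten_nil, List.append_eq_nil_iff] at h1
      exact ((h.2 u (by simp)).ne_nil hij h1.1).elim
    | cons u' P' =>
      have h1 := h.1.trans h'.1.symm
      have hu := h.2 u (by simp)
      have hu' := h'.2 u' (by simp)
      rw [List.flatten_cons, List.flatten_cons] at h1
      have huu : u = u' := by
        rcases List.append_eq_append_iff.1 h1 with ⟨t, rfl, -⟩ | ⟨t, rfl, -⟩
        · rw [hu.eq_nil_of_append hij hu', List.append_nil]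
        · rw [hu'.eq_nil_of_append hij hu, List.append_nil]
      subst huu
      rw [List.append_cancel_left_eq] at h1
      rw [ih ⟨rfl, fun v hv => h.2 v (List.mem_cons_of_mem _ hv)⟩
        ⟨h1.symm, fun v hv => h'.2 v (List.mem_cons_of_mem _ hv)⟩]

theorem partition_eq (hij : j ≠ i) {P : List (List (Arc α (β ⊕ α)))} (h : G.IsPartition i j l P) :
    G.partition i j l = P := by
  have h' : ∃ P, G.IsPartition i j l P := ⟨P, h⟩
  rw [partition, dif_pos h']
  exact h'.choose_spec.unique hij h

end Jumps

end WeightedMultigraph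

namespace WeightedMultigraph

variable {α β : Type*}

open Classical

/-! ### Words -/

/-- The letters: the jump at `j`, and the excursions from `j` to `i`. -/
def letters (G : WeightedMultigraph α β) (i j : α) : Set (List (Arc α (β ⊕ α))) :=
  {u | u = [jumpArc j] ∨ (G.withJumps i j).IsExcursion j i u}

/-- The end of a part that is marked by the given Boolean. -/
def endpoint (i j : α) (b : Bool) : α := if b then i else j

/-- A letter or its companion, so as to start at the given end. -/
noncomputable def orient (i j : α) (b : Bool) (u : List (Arc α (β ⊕ α))) :
    List (Arc α (β ⊕ α)) :=
  if b then twin i j u else u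

/-- The end at which a letter arrives. -/
noncomputable def cross (j : α) (b : Bool) (u : List (Arc α (β ⊕ α))) : Bool :=
  if u = [jumpArc j] then b else !b

/-- The parts of the alternating walk that a word describes. -/
noncomputable def unfoldWord (i j : α) :
    Bool → List (List (Arc α (β ⊕ α))) → List (List (Arc α (β ⊕ α)))
  | _, [] => []
  | b, u :: W => orient i j b u :: unfoldWord i j (cross j b u) W

variable {G : WeightedMultigraph α β} {i j : α} {u u' : List (Arc α (β ⊕ α))}

theorem jumpArc_injective : Function.Injective (jumpArc : α → Arc α (β ⊕ α)) := fun _ _ h =>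
  congrArg Arc.tail h

theorem endpoint_ne (hij : j ≠ i) (b : Bool) : endpoint i j b ≠ endpoint i j (!b) := by
  cases b
  · exact hij
  · exact hij.symm

theorem twin_jump (hij : j ≠ i) : twin i j [(jumpArc j : Arc α (β ⊕ α))] = [jumpArc i] := by
  have : ([jumpArc j] : List (Arc α (β ⊕ α))) ≠ [jumpArc i] := by
    simpa using fun h => hij (jumpArc_injective h)
  rw [twin, if_neg this, if_pos rfl]

theorem twin_jump' : twin i j [(jumpArc i : Arc α (β ⊕ α))] = [jumpArc j] := by
  rw [twin, if_pos rfl]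

theorem twin_excursion {x y : α} (hxy : x ≠ y) (h : (G.withJumps i j).IsExcursion x y u) :
    twin i j u = (u.map Arc.rev).reverse := by
  rw [twin, if_neg (h.ne_jumpArc hxy i), if_neg (h.ne_jumpArc hxy j)]

theorem twin_twin_excursion {x y : α} (hxy : x ≠ y) (h : (G.withJumps i j).IsExcursion x y u) :
    twin i j (twin i j u) = u := by
  rw [twin_excursion hxy h, twin_excursion hxy.symm h.reverse, reverse_map_rev_involutive]

theorem twin_twin (hij : j ≠ i) (hu : u ∈ G.letters i j) : twin i j (twin i j u) = u := by
  rcases hu with rfl | hu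
  · rw [twin_jump hij, twin_jump']
  · exact twin_twin_excursion hij hu

theorem partPair_orient (hij : j ≠ i) (hu : u ∈ G.letters i j) (b : Bool) :
    partPair i j (orient i j b u) = partPair i j u := by
  cases b
  · rfl
  · change s(twin i j u, twin i j (twin i j u)) = s(u, twin i j u)
    rw [twin_twin hij hu, Sym2.eq_swap]

theorem orient_jump (hij : j ≠ i) (b : Bool) :
    orient i j b [(jumpArc j : Arc α (β ⊕ α))] = [jumpArc (endpoint i j b)] := by
  cases b
  · rfl
  · exact twin_jump hij

theorem orient_excursion (hij : j ≠ i) (h : (G.withJumps i j).IsExcursion j i u) (b : Bool) :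
    (G.withJumps i j).IsExcursion (endpoint i j b) (endpoint i j (!b)) (orient i j b u) := by
  cases b
  · exact h
  · change (G.withJumps i j).IsExcursion i j (twin i j u)
    rw [twin_excursion hij h]
    exact h.reverse

theorem exists_orient_eq (hij : j ≠ i) {b : Bool}
    (h : (G.withJumps i j).IsExcursion (endpoint i j b) (endpoint i j (!b)) u) :
    ∃ v, (G.withJumps i j).IsExcursion j i v ∧ orient i j b v = u := by
  cases b
  · exact ⟨u, h, rfl⟩
  · refine ⟨(u.map Arc.rev).reverse, h.reverse, ?_⟩
    change twin i j _ = u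
    rw [twin_excursion hij h.reverse, reverse_map_rev_involutive]

/-- Letters start at `j` and their companions at `i`, so each unordered pair contains only one
letter. -/
theorem partPair_injOn (hij : j ≠ i) : Set.InjOn (partPair i j) (G.letters i j) := by
  have hstart : ∀ u ∈ G.letters i j, ∃ a r, u = a :: r ∧ a.tail = j := by
    rintro u (rfl | h)
    · exact ⟨_, _, rfl, rfl⟩
    · obtain ⟨a, r, rfl⟩ := List.exists_cons_of_ne_nil h.2.1
      exact ⟨a, r, rfl, h.1.1⟩
  have hstart' : ∀ u ∈ G.letters i j, ∃ a r, twin i j u = a :: r ∧ a.tail = i := by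
    rintro u (rfl | h)
    · exact ⟨_, _, twin_jump hij, rfl⟩
    · have h := orient_excursion hij h true
      change (G.withJumps i j).IsExcursion i j (twin i j u) at h
      obtain ⟨a, r, hu⟩ := List.exists_cons_of_ne_nil h.2.1
      rw [hu] at h
      exact ⟨a, r, hu, h.1.1⟩
  intro u hu v hv huv
  rcases Sym2.eq_iff.1 huv with ⟨h, -⟩ | ⟨h, -⟩
  · exact h
  · obtain ⟨a, r, h1, h2⟩ := hstart u hu
    obtain ⟨a', r', h3, h4⟩ := hstart' v hv
    rw [h1, h3] at h
    obtain ⟨rfl, -⟩ := List.cons.inj h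
    exact (hij (h2.symm.trans h4)).elim

theorem map_partPair_injOn (hij : j ≠ i) :
    Set.InjOn (List.map (partPair i j)) {W | ∀ u ∈ W, u ∈ G.letters i j} := by
  intro W hW W' hW' h
  induction W generalizing W' with
  | nil => exact (List.map_eq_nil_iff.1 h.symm).symm
  | cons u W ih =>
    cases W' with
    | nil => simp at h
    | cons u' W' =>
      simp only [List.map_cons, List.cons.injEq] at h
      rw [partPair_injOn hij (hW u (by simp)) (hW' u' (by simp)) h.1,
        ih (fun v hv => hW v (List.mem_cons_of_mem _ hv))
          (fun v hv => hW' v (List.mem_cons_of_mem _ hv)) h.2]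

variable {W : List (List (Arc α (β ⊕ α)))}

theorem map_partPair_unfoldWord (hij : j ≠ i) (hW : ∀ u ∈ W, u ∈ G.letters i j) (b : Bool) :
    (unfoldWord i j b W).map (partPair i j) = W.map (partPair i j) := by
  induction W generalizing b with
  | nil => rfl
  | cons u W ih =>
    rw [unfoldWord, List.map_cons, List.map_cons, partPair_orient hij (hW u (by simp)),
      ih fun v hv => hW v (List.mem_cons_of_mem _ hv)]

theorem sum_length_unfoldWord (b : Bool) :
    (unfoldWord i j b W).flatten.length = (W.map List.length).sum := by
  induction W generalizing b with
  | nil => rfl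
  | cons u W ih =>
    rw [unfoldWord, List.flatten_cons, List.length_append, ih, List.map_cons, List.sum_cons]
    cases b
    · rfl
    · rw [orient, if_pos rfl, length_twin]

theorem walkWeight_append {γ : Type*} (H : WeightedMultigraph α γ) (l l' : List (Arc α γ)) :
    H.walkWeight (l ++ l') = H.walkWeight l * H.walkWeight l' := by
  simp [walkWeight]

theorem walkWeight_unfoldWord (b : Bool) :
    (G.withJumps i j).walkWeight (unfoldWord i j b W).flatten =
      (W.map (G.withJumps i j).walkWeight).prod := by
  induction W generalizing b with
  | nil => rfl
  | cons u W ih =>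
    rw [unfoldWord, List.flatten_cons, walkWeight_append, ih, List.map_cons, List.prod_cons]
    cases b
    · rfl
    · rw [orient, if_pos rfl, walkWeight_twin]

theorem isPart_orient (hij : j ≠ i) (hu : u ∈ G.letters i j) (b : Bool) :
    G.IsPart i j (orient i j b u) := by
  rcases hu with rfl | hu
  · left
    rw [orient_jump hij]
    cases b
    · exact Or.inr rfl
    · exact Or.inl rfl
  · right
    have h := orient_excursion hij hu b
    have hne := endpoint_ne hij b
    refine ⟨?_, fun a ha => h.not_isJump hne ?_ ?_ ha⟩
    · cases b
      · exact Or.inl ⟨h.1, fun a ha => h.tail_ne hne ha⟩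
      · exact Or.inr ⟨h.1, fun a ha => h.tail_ne hne ha⟩
    · cases b
      · exact Or.inr rfl
      · exact Or.inl rfl
    · cases b
      · exact Or.inl rfl
      · exact Or.inr rfl

theorem isPartition_unfoldWord (hij : j ≠ i) (hW : ∀ u ∈ W, u ∈ G.letters i j) (b : Bool) :
    G.IsPartition i j (unfoldWord i j b W).flatten (unfoldWord i j b W) := by
  refine ⟨rfl, ?_⟩
  induction W generalizing b with
  | nil => simp [unfoldWord]
  | cons u W ih =>
    rw [unfoldWord]
    intro v hv
    rcases List.mem_cons.1 hv with rfl | hv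
    · exact isPart_orient hij (hW u (by simp)) b
    · exact ih (fun v hv => hW v (List.mem_cons_of_mem _ hv)) _ v hv

theorem routePartition_unfoldWord (hij : j ≠ i) (hW : ∀ u ∈ W, u ∈ G.letters i j) (b : Bool) :
    G.routePartition i j (unfoldWord i j b W).flatten = W.map (partPair i j) := by
  rw [routePartition, partition_eq hij (isPartition_unfoldWord hij hW b),
    map_partPair_unfoldWord hij hW]

theorem unfoldWord_isWalk (hij : j ≠ i) (hV : ∀ v, v ∈ G.vertexSet)
    (hW : ∀ u ∈ W, u ∈ G.letters i j) (b : Bool) :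
    (G.withJumps i j).IsWalk (endpoint i j b) (unfoldWord i j b W).flatten
      (endpoint i j (W.foldl (cross j) b)) := by
  induction W generalizing b with
  | nil => exact ⟨hV _, rfl⟩
  | cons u W ih =>
    rw [unfoldWord, List.flatten_cons, List.foldl_cons, isWalk_append]
    refine ⟨_, ?_, ih (fun v hv => hW v (List.mem_cons_of_mem _ hv)) _⟩
    rcases hW u (by simp) with rfl | hu
    · rw [orient_jump hij, cross, if_pos rfl]
      refine ⟨rfl, ⟨hV _, ?_, rfl, rfl⟩, hV _, rfl⟩
      cases b
      · exact Or.inr rfl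
      · exact Or.inl rfl
    · rw [cross, if_neg (hu.ne_jumpArc hij j)]
      exact (orient_excursion hij hu b).1

/-- Prepending a jump or an excursion in either direction preserves alternation. The Boolean `c`
treats the conditions at `j` and at `i` together. -/
theorem alternatesAt_unfoldWord (hij : j ≠ i) (hW : ∀ u ∈ W, u ∈ G.letters i j) (b c : Bool) :
    (G.withJumps i j).AlternatesAt (endpoint i j c) (endpoint i j !c)
      (unfoldWord i j b W).flatten := by
  induction W generalizing b with
  | nil =>
    intro s hs _
    right
    simp [List.infix_nil.1 hs]
  | cons u W ih =>
    rw [unfoldWord, List.flatten_cons]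
    have h := ih (fun v hv => hW v (List.mem_cons_of_mem _ hv)) (cross j b u)
    rcases hW u (by simp) with rfl | hu
    · rw [orient_jump hij]
      exact h.jump_append _
    · have hu' := orient_excursion hij hu b
      by_cases hbc : b = c
      · subst hbc
        exact h.excursion_append hu'
      · have : b = !c := by cases b <;> cases c <;> simp_all
        subst this
        rw [Bool.not_not] at hu'
        exact h.excursion_append' hu' (endpoint_ne hij c)

theorem isAlternating_unfoldWord (hij : j ≠ i) (hV : ∀ v, v ∈ G.vertexSet)
    (hW : ∀ u ∈ W, u ∈ G.letters i j) :
    G.IsAlternating i j (endpoint i j (W.foldl (cross j) false)) (unfoldWord i j false W).flatten :=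
  ⟨unfoldWord_isWalk hij hV hW false, alternatesAt_unfoldWord hij hW false false,
    alternatesAt_unfoldWord hij hW false true⟩

/-- Cut the walk greedily: peel off a leading jump, or else everything up to the next visit to `i`
or `j`. Alternation makes the latter piece cross to the other end. -/
theorem exists_unfoldWord_eq (hij : j ≠ i) {l : List (Arc α (β ⊕ α))} {b b' : Bool}
    (hw : (G.withJumps i j).IsWalk (endpoint i j b) l (endpoint i j b'))
    (hA : ∀ c, (G.withJumps i j).AlternatesAt (endpoint i j c) (endpoint i j !c) l) :
    ∃ W, (∀ u ∈ W, u ∈ G.letters i j) ∧ (unfoldWord i j b W).flatten = l ∧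
      W.foldl (cross j) b = b' := by
  have hinj : ∀ {b b' : Bool}, endpoint i j b = endpoint i j b' → b = b' := by
    intro b b' h
    have h1 := endpoint_ne hij b
    cases b <;> cases b' <;> simp_all
  induction hn : l.length using Nat.strong_induction_on generalizing l b with
  | _ n ih =>
  subst hn
  cases l with
  | nil => exact ⟨[], by simp, rfl, hinj hw.2⟩
  | cons a r =>
    by_cases ha : IsJump a
    · obtain ⟨h1, -⟩ := ha.eq_jumpArc hw.2.1
      rw [hw.1] at h1
      subst h1
      obtain ⟨W, hW, hWr, hWb⟩ := ih r.length (by simp) hw.2.2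
        (fun c => (hA c).of_append (l' := [_])) rfl
      refine ⟨[jumpArc j] :: W, ?_, ?_, ?_⟩
      · intro u hu
        rcases List.mem_cons.1 hu with rfl | hu
        · exact Or.inl rfl
        · exact hW u hu
      · rw [unfoldWord, orient_jump hij, cross, if_pos rfl, List.flatten_cons, hWr]
        rfl
      · rw [List.foldl_cons, cross, if_pos rfl, hWb]
    · let p : Arc α (β ⊕ α) → Bool := fun c => decide (c.tail ≠ i ∧ c.tail ≠ j)
      set r₁ := r.takeWhile p with hr₁
      set r₂ := r.dropWhile p with hr₂
      have hr : a :: r = (a :: r₁) ++ r₂ := by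
        rw [List.cons_append, hr₁, hr₂, List.takeWhile_append_dropWhile]
      have hr₁p : ∀ c ∈ r₁, c.tail ≠ i ∧ c.tail ≠ j := fun c hc => by
        simpa [p] using List.mem_takeWhile_imp hc
      rw [hr] at hw hA
      obtain ⟨y, hw₁, hw₂⟩ := isWalk_append.1 hw
      -- The piece ends at `i` or `j`: either the walk ends there, or the next arc was the first to
      -- fail `p`.
      obtain ⟨c, rfl⟩ : ∃ c, y = endpoint i j c := by
        cases h : r₂ with
        | nil =>
          rw [h] at hw₂
          exact ⟨b', hw₂.2⟩
        | cons d r₃ =>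
          rw [h] at hw₂
          have h1 : ¬ p d := by
            have := List.head_dropWhile_not p (l := r) (by rw [← hr₂, h]; simp)
            simp only [← hr₂, h, List.head_cons] at this
            simp [this]
          have h2 : d.tail = i ∨ d.tail = j := by
            by_contra h3
            rw [not_or] at h3
            exact h1 (by simpa [p] using h3)
          rcases h2 with h2 | h2
          · exact ⟨true, hw₂.1.symm.trans h2⟩
          · exact ⟨false, hw₂.1.symm.trans h2⟩
      have hend : ∀ (b : Bool) (d : Arc α (β ⊕ α)), d ∈ r₁ → d.tail ≠ endpoint i j b := by
        intro b d hd
        cases b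
        · exact (hr₁p d hd).2
        · exact (hr₁p d hd).1
      -- Otherwise the piece would be a closed subwalk that begins with a non-jump and misses the
      -- other end, against alternation.
      have hcb : c = !b := by
        by_contra hcb
        have hcb : c = b := (by decide : ∀ b c : Bool, ¬ c = !b → c = b) b c hcb
        subst hcb
        rcases hA c _ (List.prefix_append _ _).isInfix hw₁ with h | h
        · have htails : ∀ d ∈ a :: r₁, d.tail ≠ endpoint i j !c := by
            intro d hd
            rcases List.mem_cons.1 hd with rfl | hd
            · rw [hw₁.1]
              exact endpoint_ne hij c
            · exact hend _ d hd
          obtain ⟨d, hd, h | h⟩ := h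
          · exact htails d hd h
          · have h1 : d.head ∈ endpoint i j c :: (a :: r₁).map Arc.head :=
              List.mem_cons_of_mem _ (List.mem_map_of_mem hd)
            rw [hw₁.cons_map_head, List.mem_append, List.mem_singleton] at h1
            rcases h1 with h1 | h1
            · obtain ⟨e, he, h2⟩ := List.mem_map.1 h1
              exact htails e he (h2.trans h)
            · exact endpoint_ne hij c (h1.symm.trans h)
        · exact ha (h a (by simp))
      subst hcb
      have hexc : (G.withJumps i j).IsExcursion (endpoint i j b) (endpoint i j !b) (a :: r₁) :=
        ⟨hw₁, by simp, fun d hd => ⟨hend _ d hd, hend _ d hd⟩⟩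
      obtain ⟨u, hu, huo⟩ := exists_orient_eq hij hexc
      have hlt : r₂.length < (a :: r).length := by
        rw [hr]; simp
      obtain ⟨W, hW, hWr, hWb⟩ := ih r₂.length hlt hw₂ (fun c => (hA c).of_append) rfl
      refine ⟨u :: W, ?_, ?_, ?_⟩
      · intro v hv
        rcases List.mem_cons.1 hv with rfl | hv
        · exact Or.inr hu
        · exact hW v hv
      · rw [unfoldWord, cross, if_neg (hu.ne_jumpArc hij j), List.flatten_cons, hWr, huo, hr]
      · rw [List.foldl_cons, cross, if_neg (hu.ne_jumpArc hij j), hWb]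

theorem isAlternating_iff (hij : j ≠ i) (hV : ∀ v, v ∈ G.vertexSet) (b : Bool)
    {l : List (Arc α (β ⊕ α))} :
    G.IsAlternating i j (endpoint i j b) l ↔
      ∃ W, (∀ u ∈ W, u ∈ G.letters i j) ∧ (unfoldWord i j false W).flatten = l ∧
        W.foldl (cross j) false = b := by
  constructor
  · rintro ⟨h1, h2, h3⟩
    refine exists_unfoldWord_eq (b := false) hij h1 fun c => ?_
    cases c
    · exact h2
    · exact h3
  · rintro ⟨W, hW, rfl, rfl⟩
    exact isAlternating_unfoldWord hij hV hW

/-- The final state depends only on the parity of the number of excursions, so the order of the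
letters does not matter. -/
theorem foldl_cross_isRotated {W' : List (List (Arc α (β ⊕ α)))} (h : W ~r W') (b : Bool) :
    W.foldl (cross j) b = W'.foldl (cross j) b := by
  have : RightCommutative (cross j : Bool → List (Arc α (β ⊕ α)) → Bool) :=
    ⟨fun b u v => by unfold cross; split_ifs <;> rfl⟩
  exact h.perm.foldl_eq b

/-- The signed weight of a letter. -/
noncomputable def letterWeight (G : WeightedMultigraph α β) (i j : α)
    (u : List (Arc α (β ⊕ α))) : ℝ :=
  if u = [jumpArc j] then 1 else -(G.withJumps i j).walkWeight u

theorem prod_letterWeight :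
    (W.map (G.letterWeight i j)).prod =
      (if W.foldl (cross j) false then -1 else 1) * (W.map (G.withJumps i j).walkWeight).prod := by
  -- The state changes along the word, so the induction needs an arbitrary initial state.
  have key : ∀ b, (if b then (-1 : ℝ) else 1) * (W.map (G.letterWeight i j)).prod =
      (if W.foldl (cross j) b then -1 else 1) * (W.map (G.withJumps i j).walkWeight).prod := by
    induction W with
    | nil => simp
    | cons u W ih =>
      intro b
      rw [List.foldl_cons, List.map_cons, List.prod_cons, List.map_cons, List.prod_cons,
        mul_left_comm (ite _ _ _) ((G.withJumps i j).walkWeight u), ← ih]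
      by_cases hu : u = [jumpArc j]
      · subst hu
        simp [letterWeight, cross, walkWeight, jumpArc, withJumps]
      · cases b <;> simp [letterWeight, cross, hu]
  simpa using key false

end WeightedMultigraph

namespace WeightedMultigraph

variable {α β : Type*}

open Classical

/-! ### Circuits -/

theorem IsWalk.isRotated {H : WeightedMultigraph α β} {x : α} {l l' : List (Arc α β)}
    (h : H.IsWalk x l x) (hl : l ~r l') : ∃ y, H.IsWalk y l' y := by
  obtain ⟨k, rfl⟩ := hl
  rw [List.rotate_eq_drop_append_take_mod]
  rw [← List.take_append_drop (k % l.length) l, isWalk_append] at h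
  obtain ⟨y, h1, h2⟩ := h
  exact ⟨y, isWalk_append.2 ⟨x, h2, h1⟩⟩

theorem isWalk_deletePair {G : WeightedMultigraph α β} {i j x y : α} {l : List (Arc α β)} :
    (G.deletePair i j).IsWalk x l y ↔
      G.IsWalk x l y ∧ (∀ a ∈ l, a.tail ∈ ({i, j} : Set α)ᶜ) ∧ y ∈ ({i, j} : Set α)ᶜ := by
  induction l generalizing x with
  | nil =>
    simp only [IsWalk, deletePair, Graph.vertexSet_deleteVerts, Set.mem_sdiff, Set.mem_compl_iff]
    constructor
    · rintro ⟨⟨h1, h2⟩, rfl⟩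
      exact ⟨⟨h1, rfl⟩, by simp, h2⟩
    · rintro ⟨⟨h1, rfl⟩, -, h2⟩
      exact ⟨⟨h1, h2⟩, rfl⟩
  | cons a l ih =>
    have hl : (G.deletePair i j).IsLink a.edge a.tail a.head ↔
        G.IsLink a.edge a.tail a.head ∧ a.tail ∉ ({i, j} : Set α) ∧ a.head ∉ ({i, j} : Set α) :=
      Graph.deleteVerts_isLink _ _
    simp only [IsWalk, ih, hl, List.mem_cons, forall_eq_or_imp]
    constructor
    · rintro ⟨h1, ⟨h2, h3, -⟩, h4, h5, h6⟩
      exact ⟨⟨h1, h2, h4⟩, ⟨h3, h5⟩, h6⟩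
    · rintro ⟨⟨h1, h2, h4⟩, ⟨h3, h5⟩, h6⟩
      refine ⟨h1, ⟨h2, h3, ?_⟩, h4, h5, h6⟩
      cases l with
      | nil => exact h4.2 ▸ h6
      | cons b l => exact h4.1 ▸ h5 b (by simp)

theorem finsum_circuits {n : ℕ} [Fintype β] (G : WeightedMultigraph (Fin (n + 1)) β)
    (i j : Fin (n + 1)) (k : ℕ) :
    ∑ᶠ c ∈ {c : (G.deletePair i j).circuits | c.1.length = k + 1},
        (G.deletePair i j).circuitWeight c.1 / (circuitMultiplicity c.1 : ℝ) =
      (∑ x, if x ∈ ({i, j} : Set (Fin (n + 1)))ᶜ then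
        (G.adjMatrix * (Matrix.avoid i j * G.adjMatrix) ^ k) x x else 0) / ((k + 1 : ℕ) : ℝ) := by
  set N : Set (Fin (n + 1)) := {i, j}ᶜ with hN
  set S : Set (List (Arc (Fin (n + 1)) β)) :=
    {l | l.length = k + 1 ∧ ∃ x, (G.deletePair i j).IsWalk x l x} with hS
  have hSfin : S.Finite := (List.finite_length_eq _ (k + 1)).subset fun l hl => hl.1
  have hne : ∀ l ∈ S, l ≠ [] := by
    rintro l ⟨h, -⟩ rfl
    simp at h
  rw [finsum_div_multiplicity (S := S) (f := G.walkWeight)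
    (J := {c : (G.deletePair i j).circuits | c.1.length = k + 1}) (κ := fun c => c.1)
    (g := fun c => (G.deletePair i j).circuitWeight c.1) (μ := fun c => circuitMultiplicity c.1)
    hSfin hne]
  · have hSU : S = ⋃ x ∈ N, G.innerWalks N x x k := by
      ext l
      simp only [hS, Set.mem_ofPred_eq, Set.mem_iUnion, exists_prop, isWalk_deletePair, innerWalks]
      constructor
      · rintro ⟨hl, x, h1, h2, h3⟩
        exact ⟨x, h3, h1, hl, fun a ha => h2 a (List.mem_of_mem_tail ha)⟩
      · rintro ⟨x, h3, h1, hl, h2⟩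
        refine ⟨hl, x, h1, fun a ha => ?_, h3⟩
        cases l with
        | nil => simp at hl
        | cons b l =>
          rcases List.mem_cons.1 ha with rfl | ha
          · rw [h1.1]; exact h3
          · exact h2 a ha
    have hQ : (Matrix.diagonal fun v => if v ∈ N then (1 : ℝ) else 0) = Matrix.avoid i j := by
      rw [Matrix.avoid]
    have h1 : ∀ l ∈ S, G.walkWeight l / l.length = (1 / ((k + 1 : ℕ) : ℝ)) * G.walkWeight l := by
      intro l hl
      rw [hl.1]
      ring
    rw [finsum_mem_congr rfl h1, ← mul_finsum_mem' _ _ hSfin, hSU, finsum_mem_biUnion]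
    · rw [finsum_mem_congr rfl fun x _ => G.finsum_innerWalks N x x k, hQ,
        finsum_mem_eq_finite_toFinset_sum _ N.toFinite, Finset.sum_ite, Finset.sum_const_zero,
        add_zero, one_div, inv_mul_eq_div]
      congr 1
      refine Finset.sum_congr ?_ fun _ _ => rfl
      ext x
      simp
    · intro x _ y _ hxy
      refine Set.disjoint_left.2 fun l h h' => hxy ?_
      have h2 := h.1
      have h3 := h'.1
      cases l with
      | nil => simpa using h.2.1
      | cons a l => exact h2.1.symm.trans h3.1
    · exact N.toFinite
    · exact fun x _ => G.finite_innerWalks N x x k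
  · rintro l ⟨h1, x, h2⟩ l' hl
    exact ⟨hl.perm.length_eq ▸ h1, h2.isRotated hl⟩
  · exact Subtype.val_injective.injOn
  · ext c
    simp only [Set.mem_image, Set.mem_ofPred_eq, hS]
    constructor
    · rintro ⟨⟨_, x, l, h1, h2, rfl⟩, h3, rfl⟩
      exact ⟨l, ⟨h3, x, h2⟩, rfl⟩
    · rintro ⟨l, ⟨h1, x, h2⟩, rfl⟩
      refine ⟨⟨l, x, l, hne l ⟨h1, x, h2⟩, h2, rfl⟩, h1, rfl⟩
  · rintro ⟨c, hc⟩ - l hl rfl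
    refine ⟨?_, Cycle.sSup_isRepetition (hne l hl)⟩
    simp [circuitWeight, walkWeight, deletePair]

/-! ### Routes -/

theorem Route.cyclicPartition_injective {G : WeightedMultigraph α β} {i j z : α} :
    Function.Injective (Route.cyclicPartition : G.Route i j z → _) := by
  intro r r' h
  induction r using Quotient.inductionOn
  induction r' using Quotient.inductionOn
  exact Quotient.sound (Cycle.coe_eq_coe.1 h)

/-- The words of total length `k`. -/
def words (G : WeightedMultigraph α β) (i j : α) (k : ℕ) : Set (List (List (Arc α (β ⊕ α)))) :=
  {W | (∀ u ∈ W, u ∈ G.letters i j) ∧ (W.map List.length).sum = k}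

/-- The cyclic partition embeds the routes into cycles of pairs, and its image is that of the words
ending in state `b`. This is the setting of `finsum_div_multiplicity`. -/
theorem finsum_routes {G : WeightedMultigraph α β} {i j z : α} {b : Bool} (hij : j ≠ i)
    (hV : ∀ v, v ∈ G.vertexSet) (hz : endpoint i j b = z) {k : ℕ} (hk : 1 ≤ k)
    (hfin : (G.words i j k).Finite) :
    ∑ᶠ r ∈ {r : G.Route i j z | r.length = k}, r.weight / (r.multiplicity : ℝ) =
      ∑ᶠ W ∈ {W | W ∈ G.words i j k ∧ W.foldl (cross j) false = b},
        (W.map (G.withJumps i j).walkWeight).prod / (W.length : ℝ) := by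
  subst hz
  set T := {W | W ∈ G.words i j k ∧ W.foldl (cross j) false = b} with hT
  set S := List.map (partPair i j) '' T with hS
  -- The weight descends to pairs because a part and its companion weigh the same; the default 0 is
  -- never used on pairs that occur.
  set φ : Sym2 (List (Arc α (β ⊕ α))) → ℝ :=
    Function.extend (partPair i j) (G.withJumps i j).walkWeight 0 with hφ
  have hφe : ∀ u, φ (partPair i j u) = (G.withJumps i j).walkWeight u := fun u =>
    (partPair_factors i j _ (G.walkWeight_twin i j)).extend_apply _ u
  have hφW : ∀ W : List (List (Arc α (β ⊕ α))), ((W.map (partPair i j)).map φ).prod =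
      (W.map (G.withJumps i j).walkWeight).prod := by
    intro W
    rw [List.map_map]
    congr 1
    exact List.map_congr_left fun u _ => hφe u
  have hne : ∀ W ∈ T, W ≠ [] := by
    rintro W ⟨⟨-, h⟩, -⟩ rfl
    simp at h
    omega
  have hneS : ∀ P ∈ S, P ≠ [] := by
    rintro _ ⟨W, hW, rfl⟩
    simpa using hne W hW
  have hTfin : T.Finite := hfin.subset fun W hW => hW.1
  rw [finsum_div_multiplicity (S := S) (f := fun P => (P.map φ).prod) (κ := Route.cyclicPartition)
    (hTfin.image _) hneS]
  · rw [finsum_mem_image ((map_partPair_injOn hij).mono fun W hW => hW.1.1)]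
    refine finsum_mem_congr rfl fun W _ => ?_
    rw [hφW, List.length_map]
  · rintro _ ⟨W, ⟨⟨h1, h2⟩, h3⟩, rfl⟩ _ ⟨m, rfl⟩
    have hr : W ~r W.rotate m := ⟨m, rfl⟩
    refine ⟨W.rotate m, ⟨⟨fun u hu => h1 u (List.mem_rotate.1 hu), ?_⟩, ?_⟩, ?_⟩
    · rw [← h2]
      exact ((hr.perm.map _).sum_eq).symm
    · rw [← h3, foldl_cross_isRotated hr]
    · rw [List.map_rotate]
  · exact Route.cyclicPartition_injective.injOn
  · ext c
    simp only [Set.mem_image, Set.mem_ofPred_eq, hS]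
    constructor
    · rintro ⟨r, hr, rfl⟩
      induction r using Quotient.inductionOn with
      | _ l =>
      obtain ⟨l, hl⟩ := l
      obtain ⟨W, hW, rfl, hb⟩ := (isAlternating_iff hij hV b).1 hl
      refine ⟨_, ⟨W, ⟨⟨hW, ?_⟩, hb⟩, rfl⟩, ?_⟩
      · rw [← sum_length_unfoldWord (i := i) (j := j) false]
        exact hr
      · rw [← routePartition_unfoldWord hij hW false]
        rfl
    · rintro ⟨_, ⟨W, ⟨⟨hW, hk⟩, hb⟩, rfl⟩, rfl⟩
      refine ⟨Quotient.mk _ ⟨(unfoldWord i j false W).flatten,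
        (isAlternating_iff hij hV b).2 ⟨W, hW, rfl, hb⟩⟩, ?_, ?_⟩
      · rw [← hk, ← sum_length_unfoldWord (i := i) (j := j) false]
        rfl
      · rw [← routePartition_unfoldWord hij hW false]
        rfl
  · intro r _ P hP hrP
    refine ⟨?_, ?_⟩
    · induction r using Quotient.inductionOn with
      | _ l =>
      obtain ⟨l, hl⟩ := l
      obtain ⟨W, hW, rfl, hb⟩ := (isAlternating_iff hij hV b).1 hl
      have h1 : W.map (partPair i j) ~r P := by
        rw [← routePartition_unfoldWord hij hW false]
        exact Cycle.coe_eq_coe.1 hrP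
      rw [← (h1.perm.map φ).prod_eq, hφW, ← walkWeight_unfoldWord (i := i) (j := j) false]
      rfl
    · rw [Route.multiplicity, Route.period, hrP, Cycle.sInf_isRepetition (hneS P hP)]
      rfl

/-! ### The letters -/

theorem adjMatrix_withJumps [DecidableEq α] [Fintype α] [Fintype β] (G : WeightedMultigraph α β)
    {i j : α} (hij : j ≠ i) (hV : ∀ v, v ∈ G.vertexSet) :
    (G.withJumps i j).adjMatrix = G.adjMatrix + (Matrix.single i i 1 + Matrix.single j j 1) := by
  ext x y
  simp only [adjMatrix, Matrix.of_apply, Fintype.sum_sum_type, Matrix.add_apply]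
  congr 1
  have : ∀ v : α, (if (G.withJumps i j).IsLink (Sum.inr v) x y then
      (G.withJumps i j).weight (Sum.inr v) else 0) =
      (if v = i then Matrix.single i i (1 : ℝ) x y else 0) +
        if v = j then Matrix.single j j (1 : ℝ) x y else 0 := by
    intro v
    have hl : (G.withJumps i j).IsLink (Sum.inr v) x y ↔
        v ∈ G.vertexSet ∧ (v = i ∨ v = j) ∧ x = v ∧ y = v := Iff.rfl
    have hw : (G.withJumps i j).weight (Sum.inr v) = 1 := rfl
    simp only [hl, hw, hV v, true_and, Matrix.single_apply]
    by_cases hi : v = i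
    · subst hi
      simp [hij.symm, eq_comm]
    · by_cases hj : v = j
      · subst hj
        simp [hij, eq_comm]
      · simp [hi, hj]
  rw [Fintype.sum_congr _ _ this, Finset.sum_add_distrib]
  simp

theorem letters_finite [Finite α] [Finite β] (G : WeightedMultigraph α β) (i j : α) (m : ℕ) :
    {u | u ∈ G.letters i j ∧ u.length = m}.Finite := by
  have := Fintype.ofFinite α
  have := Fintype.ofFinite β
  exact (List.finite_length_eq _ m).subset fun u hu => hu.2

/-- Identifies the generating series of the signed letters with the return series of the matrix
computation. -/
theorem sum_letterWeight {n : ℕ} [Fintype β] {G : WeightedMultigraph (Fin (n + 1)) β}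
    {i j : Fin (n + 1)} (hij : j ≠ i) (hV : ∀ v, v ∈ G.vertexSet) (m : ℕ) :
    ∑ u ∈ (G.letters_finite i j (m + 1)).toFinset, G.letterWeight i j u =
      (if m = 0 then 1 else 0) - (G.adjMatrix * (Matrix.avoid i j * G.adjMatrix) ^ m) j i := by
  set H := G.withJumps i j with hH
  set N : Set (Fin (n + 1)) := {i, j}ᶜ with hN
  have hQ : (Matrix.diagonal fun v => if v ∈ N then (1 : ℝ) else 0) = Matrix.avoid i j := by
    rw [Matrix.avoid]
  have hset : {u | u ∈ G.letters i j ∧ u.length = m + 1} =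
      {u | u = [jumpArc j] ∧ m = 0} ∪ H.innerWalks N j i m := by
    ext u
    simp only [letters, Set.mem_ofPred_eq, Set.mem_union, innerWalks, IsExcursion]
    constructor
    · rintro ⟨rfl | ⟨h1, h2, h3⟩, h4⟩
      · exact Or.inl ⟨rfl, by simpa using h4.symm⟩
      · exact Or.inr ⟨h1, h4, fun a ha => by simpa [hN, and_comm] using h3 a ha⟩
    · rintro (⟨rfl, rfl⟩ | ⟨h1, h2, h3⟩)
      · exact ⟨Or.inl rfl, rfl⟩
      · refine ⟨Or.inr ⟨h1, ?_, fun a ha => by simpa [hN, and_comm] using h3 a ha⟩, h2⟩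
        rintro rfl
        simp at h2
  have hjump : ∀ u ∈ H.innerWalks N j i m, u ≠ [jumpArc j] := by
    rintro u hu rfl
    exact hij hu.1.2.2.2
  have hdisj : Disjoint {u | u = [jumpArc j] ∧ m = 0} (H.innerWalks N j i m) :=
    Set.disjoint_left.2 fun u h h' => hjump u h' h.1
  -- The jumps alter the adjacency matrix only in rows `i` and `j`, which `avoid` kills; `hrow`
  -- disposes of a jump as first arc.
  have hAQ : Matrix.avoid i j * H.adjMatrix = Matrix.avoid i j * G.adjMatrix := by
    rw [adjMatrix_withJumps G hij hV, mul_add, add_eq_left, mul_add]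
    ext x y
    rw [Matrix.avoid, Matrix.add_apply, Matrix.diagonal_mul, Matrix.diagonal_mul,
      Matrix.single_apply, Matrix.single_apply]
    by_cases hi : x = i
    · simp [hi]
    · by_cases hj : x = j
      · simp [hj]
      · simp [Ne.symm hi, Ne.symm hj]
  have hrow : ((Matrix.avoid i j * G.adjMatrix) ^ m) j i = 0 := by
    cases m with
    | zero => simp [hij]
    | succ m =>
      rw [pow_succ', Matrix.mul_assoc]
      conv_lhs => rw [Matrix.avoid, Matrix.diagonal_mul]
      simp
  have hwalk : ∑ᶠ u ∈ H.innerWalks N j i m, G.letterWeight i j u =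
      -(G.adjMatrix * (Matrix.avoid i j * G.adjMatrix) ^ m) j i := by
    have h1 : ∀ u ∈ H.innerWalks N j i m, G.letterWeight i j u = -1 * H.walkWeight u := by
      intro u hu
      rw [letterWeight, if_neg (hjump u hu), neg_one_mul]
    rw [finsum_mem_congr rfl h1, ← mul_finsum_mem' _ _ (H.finite_innerWalks N j i m),
      H.finsum_innerWalks N j i m, hQ, hAQ, adjMatrix_withJumps G hij hV, add_mul, neg_one_mul,
      Matrix.add_apply, add_mul, Matrix.add_apply, Matrix.single_mul_apply_same,
      Matrix.single_mul_apply_of_ne _ _ _ _ _ hij, hrow]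
    simp
  rw [← finsum_mem_eq_finite_toFinset_sum, hset, finsum_mem_union hdisj, hwalk, sub_eq_add_neg]
  · congr 1
    by_cases hm : m = 0
    · simp [hm, letterWeight]
    · simp [hm]
  · exact (Set.finite_singleton [jumpArc j]).subset fun u hu => hu.1
  · exact H.finite_innerWalks N j i m

/-! ### Figures -/

theorem figures_finite [Finite α] [Finite β] (G : WeightedMultigraph α β) (i j : α) (k : ℕ) :
    {c : G.Figure i j | c.length = k}.Finite := by
  have := Fintype.ofFinite α
  have := Fintype.ofFinite β
  have hc : {c : (G.deletePair i j).circuits | c.1.length = k}.Finite := by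
    refine Set.Finite.of_finite_image (f := Subtype.val) ?_ Subtype.val_injective.injOn
    refine ((List.finite_length_eq (Arc α β) k).image fun l : List (Arc α β) => (l : Cycle (Arc α β))).subset ?_
    rintro _ ⟨⟨_, x, l, h1, h2, rfl⟩, h3, rfl⟩
    exact ⟨l, h3, rfl⟩
  have hr : ∀ z, {r : G.Route i j z | r.length = k}.Finite := by
    intro z
    have h1 : {l : G.AlternatingWalk i j z | l.1.length = k}.Finite :=
      (List.finite_length_eq (Arc α (β ⊕ α)) k).preimage Subtype.val_injective.injOn
    refine (h1.image (Quotient.mk (G.equipartite i j z))).subset ?_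
    intro r hr
    induction r using Quotient.inductionOn with
    | _ l => exact ⟨l, hr, rfl⟩
  refine ((hc.image Figure.circuit).union (((hr j).image Figure.closedRoute).union
    ((hr i).image Figure.openRoute))).subset ?_
  rintro (c | r | r) h
  · exact Or.inl ⟨c, h, rfl⟩
  · exact Or.inr (Or.inl ⟨r, h, rfl⟩)
  · exact Or.inr (Or.inr ⟨r, h, rfl⟩)

theorem finsum_figures [Finite α] [Finite β] (G : WeightedMultigraph α β) (i j : α) (k : ℕ) :
    ∑ᶠ c ∈ {c : G.Figure i j | c.length = k},
        (-1 : ℝ) ^ c.zeta * (c.weight / (c.multiplicity : ℝ)) =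
      ∑ᶠ c ∈ {c : (G.deletePair i j).circuits | c.1.length = k},
        (G.deletePair i j).circuitWeight c.1 / (circuitMultiplicity c.1 : ℝ) +
      (∑ᶠ r ∈ {r : G.Route i j j | r.length = k}, r.weight / (r.multiplicity : ℝ) -
        ∑ᶠ r ∈ {r : G.Route i j i | r.length = k}, r.weight / (r.multiplicity : ℝ)) := by
  have hU : {c : G.Figure i j | c.length = k} =
      Figure.circuit '' {c | c.1.length = k} ∪ (Figure.closedRoute '' {r | r.length = k} ∪
        Figure.openRoute '' {r | r.length = k}) := by
    ext c
    constructor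
    · rcases c with c | r | r <;> intro h
      · exact Or.inl ⟨c, h, rfl⟩
      · exact Or.inr (Or.inl ⟨r, h, rfl⟩)
      · exact Or.inr (Or.inr ⟨r, h, rfl⟩)
    · rintro (⟨c, h, rfl⟩ | ⟨r, h, rfl⟩ | ⟨r, h, rfl⟩) <;> exact h
  have hfin := G.figures_finite i j k
  rw [hU] at hfin ⊢
  have hf1 := hfin.subset Set.subset_union_left
  have hf2 := hfin.subset Set.subset_union_right
  have hf3 := hf2.subset Set.subset_union_left
  have hf4 := hf2.subset Set.subset_union_right
  have hfo : {r : G.Route i j i | r.length = k}.Finite :=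
    hf4.of_finite_image fun _ _ _ _ h => Figure.openRoute.inj h
  rw [finsum_mem_union _ hf1 hf2, finsum_mem_union _ hf3 hf4,
    finsum_mem_image fun _ _ _ _ h => Figure.circuit.inj h,
    finsum_mem_image fun _ _ _ _ h => Figure.closedRoute.inj h,
    finsum_mem_image fun _ _ _ _ h => Figure.openRoute.inj h, sub_eq_add_neg,
    ← finsum_mem_neg_distrib _ hfo]
  · simp only [Figure.zeta, Figure.weight, Figure.multiplicity, pow_zero, pow_one, one_mul,
      neg_one_mul]
  · refine Set.disjoint_left.2 ?_
    rintro _ ⟨r, -, rfl⟩ ⟨r', -, h⟩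
    cases h
  · refine Set.disjoint_left.2 ?_
    rintro _ ⟨r, -, rfl⟩ (⟨r', -, h⟩ | ⟨r', -, h⟩) <;> cases h

/-- Closed and open routes are the words in final state `false` and `true`, so their difference is
one sum over all words with the signs absorbed into the letters. -/
theorem finsum_routes_sub {n : ℕ} [Fintype β] {G : WeightedMultigraph (Fin (n + 1)) β}
    {i j : Fin (n + 1)} (hij : j ≠ i) (hV : ∀ v, v ∈ G.vertexSet) {k : ℕ} (hk : 1 ≤ k) :
    ∑ᶠ r ∈ {r : G.Route i j j | r.length = k}, r.weight / (r.multiplicity : ℝ) -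
        ∑ᶠ r ∈ {r : G.Route i j i | r.length = k}, r.weight / (r.multiplicity : ℝ) =
      ∑ s ∈ Finset.range k, PowerSeries.coeff k ((PowerSeries.mk fun m =>
        ∑ u ∈ (G.letters_finite i j m).toFinset, G.letterWeight i j u) ^ (s + 1)) / (s + 1) := by
  have hL : ∀ m u, u ∈ (G.letters_finite i j m).toFinset ↔ u ∈ G.letters i j ∧ u.length = m := by
    intro m u
    simp
  have h0 : (G.letters_finite i j 0).toFinset = ∅ := by
    refine Finset.eq_empty_of_forall_notMem fun u hu => ?_
    obtain ⟨rfl | h, h1⟩ := (hL 0 u).1 hu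
    · simp at h1
    · exact h.2.1 (List.length_eq_zero_iff.1 h1)
  obtain ⟨hfin, hsum⟩ := finsum_words_div_length hL h0 (G.letterWeight i j) hk
  change (G.words i j k).Finite at hfin
  change ∑ᶠ W ∈ G.words i j k, _ = _ at hsum
  have hb : ∀ b, {W | W ∈ G.words i j k ∧ W.foldl (cross j) false = b}.Finite := fun b =>
    hfin.subset fun W hW => hW.1
  have hU : G.words i j k = {W | W ∈ G.words i j k ∧ W.foldl (cross j) false = false} ∪
      {W | W ∈ G.words i j k ∧ W.foldl (cross j) false = true} := by
    ext W
    simp only [Set.mem_union, Set.mem_ofPred_eq, ← and_or_left]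
    cases List.foldl (cross j) false W <;> simp
  rw [← hsum, finsum_routes (z := j) hij hV (b := false) rfl hk hfin,
    finsum_routes (z := i) hij hV (b := true) rfl hk hfin, hU, finsum_mem_union _ (hb _) (hb _), ← hU,
    sub_eq_add_neg, ← finsum_mem_neg_distrib _ (hb _)]
  · congr 1
    · refine finsum_mem_congr rfl fun W hW => ?_
      rw [prod_letterWeight, hW.2]
      simp
    · refine finsum_mem_congr rfl fun W hW => ?_
      rw [prod_letterWeight, hW.2]
      simp
      ring
  · refine Set.disjoint_left.2 fun W h h' => ?_
    have := h.2.symm.trans h'.2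
    simp at this

theorem adjMatrix_scale [Fintype β] (G : WeightedMultigraph α β) (t : ℝ) :
    (G.scale t).adjMatrix = t • G.adjMatrix := by
  ext x y
  simp only [adjMatrix, Matrix.of_apply, Matrix.smul_apply, smul_eq_mul, Finset.mul_sum]
  refine Finset.sum_congr rfl fun e _ => ?_
  change (if G.IsLink e x y then t * G.weight e else 0) = _
  by_cases h : G.IsLink e x y
  · rw [if_pos h, if_pos h]
  · rw [if_neg h, if_neg h, mul_zero]

/-- The figures of length `k + 1` add up to the normalized trace of a power of
`1 - B_(ij) T_(ji)`. -/
theorem finsum_figures_eq_trace {n : ℕ} [Fintype β] {G : WeightedMultigraph (Fin (n + 1)) β}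
    {i j : Fin (n + 1)} (hij : j ≠ i) (hV : ∀ v, v ∈ G.vertexSet) (k : ℕ) :
    ∑ᶠ c ∈ {c : G.Figure i j | c.length = k + 1},
        (-1 : ℝ) ^ c.zeta * (c.weight / (c.multiplicity : ℝ)) =
      ((1 - (1 - G.adjMatrix).removeRowCol i j * Matrix.transfer j i) ^ (k + 1)).trace /
        ((k + 1 : ℕ) : ℝ) := by
  rw [finsum_figures, finsum_circuits, finsum_routes_sub hij hV (Nat.le_add_left 1 k),
    Matrix.trace_pow_div G.adjMatrix hij]
  · rw [PowerSeries.coeff_mk]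
    refine Finset.sum_eq_zero fun u hu => ?_
    obtain ⟨rfl | h, h1⟩ := (Set.Finite.mem_toFinset _).1 hu
    · simp at h1
    · exact (h.2.1 (List.length_eq_zero_iff.1 h1)).elim
  · intro m
    rw [PowerSeries.coeff_mk, sum_letterWeight hij hV]

end WeightedMultigraph

theorem mainTheorem2 {n : ℕ} (hn : 2 < n + 1) {β : Type*} [Fintype β]
    (G : WeightedMultigraph (Fin (n + 1)) β)
    (hV : G.vertexSet = Set.univ)
    (hw : ∀ e ∈ G.edgeSet, 0 < G.weight e)
    (hG : G.IsConnected)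
    (t : ℝ) (ht : 0 < t) (htρ : ENNReal.ofReal t < G.adjMatrix.specRad⁻¹)
    (i j : Fin (n + 1)) (hij : j ≠ i) (heven : Even ((i : ℕ) + (j : ℕ)))
    (B : Matrix (Fin (n + 1)) (Fin (n + 1)) ℝ) (hB : B = 1 - t • G.adjMatrix)
    (hρ : (1 - B.removeRowCol i j * Matrix.transfer j i).specRad < 1) :
    0 < (B.removeRowCol i j).det ∧
    (∀ k : ℕ, {c : (G.scale t).Figure i j | c.length = k}.Finite) ∧
    HasSum
      (fun k : ℕ => ∑ᶠ c ∈ {c : (G.scale t).Figure i j | c.length = k + 1},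
        (-1 : ℝ) ^ c.zeta * (c.weight / (c.multiplicity : ℝ)))
      (-Real.log (B.removeRowCol i j).det) := by
  obtain ⟨h1, h2⟩ := Matrix.det_one_sub_pos_and_hasSum _ hρ
  -- 1 - C is the product B_(ij) T_(ji), and its second factor has determinant 1.
  rw [sub_sub_cancel, Matrix.det_mul, Matrix.det_transfer hij heven, mul_one] at h1 h2
  refine ⟨h1, (G.scale t).figures_finite i j, ?_⟩
  have hV' : ∀ v, v ∈ (G.scale t).vertexSet := fun v => by
    change v ∈ G.vertexSet
    rw [hV]
    trivial
  convert! h2 using 2 with k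
  rw [WeightedMultigraph.finsum_figures_eq_trace hij hV', G.adjMatrix_scale t, hB]
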